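/- Let $p$ be an odd prime, $m\ge 1$ and $q=p^m$. Fix an $\mathbb F_p$-linear isomorphism $\mathbb F_q\cong\mathbb F_p^m$, let $\alpha_1,\dots,\alpha_{q-1}$ be the nonzero elements of $\mathbb F_q$, and let $d(p,m,2)$ be the minimum distance (the smallest Hamming weight of a nonzero codeword) of the linear code over $\mathbb F_p$ generated by the rows of the matrix $$\begin{pmatrix}\alpha_1&\alpha_2&\cdots&\alpha_{q-1}\\ \alpha_1^2&\alpha_2^2&\cdots&\alpha_{q-1}^2\end{pmatrix}\in\mathbb F_p^{2m\times(q-1)},$$ where each $\alpha_j^i$ is viewed as a column vector in $\mathbb F_p^m$. For $f\in\mathbb F_q[x]$ let $E_f=\mathbb F_q(x,y)$, with $x$ transcendental over $\mathbb F_q$ and $y^p-y=f(x)$, be the function field of the Artin–Schreier curve defined by $f$, and let $N(E_f)$ be the number of its rational places, that is, places of degree one. Then for every $f\in\mathbb F_q[x]$ with $\deg f=2$, the number $N(E_f)$ is finite and $$N(E_f)\le 1+p\,(q-d(p,m,2))=\begin{cases}q+1+p^{\frac{m+1}2}&\text{if }m\text{ is odd},\\ q+1+(p-1)p^{\frac m2}&\text{if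 }m\text{ is even}.\end{cases}$$ For all such $p$ and $m$ the bound is attained: there is $f\in\mathbb F_q[x]$ with $\deg f=2$ and $N(E_f)=1+p(q-d(p,m,2))$. Moreover, if $m$ is odd, the bound is at most the Serre bound $q+1+\frac{p-1}2\lfloor 2\sqrt q\rfloor$ for these curves, and it is strictly smaller if and only if $q\ne 3$. -/

import Mathlib

universe u v

open scoped Polynomial

/-- A place of the function field `E` over the constant field `F`, given by its valuation ring:
a valuation ring `O` of `E` with `F ⊆ O ≠ E`. -/
structure Place (F E : Type*) [Field F] [Field E] [Algebra F E] where
  ring : ValuationSubring E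
  algebraMap_mem : ∀ a : F, algebraMap F E a ∈ ring
  ne_top : ring ≠ ⊤

namespace Place

variable {F E : Type*} [Field F] [Field E] [Algebra F E]

/-- The valuation ring of a place is an algebra over the constant field. -/
noncomputable instance (P : Place F E) : Algebra F P.ring :=
  ((algebraMap F E).codRestrict P.ring.toSubring P.algebraMap_mem).toAlgebra

/-- The degree of a place: the degree over `F` of its residue field. -/
noncomputable def degree (P : Place F E) : ℕ :=
  Module.finrank F (IsLocalRing.ResidueField P.ring)

end Place

/-- The set of rational places (places of degree one) of `E` over `F`. -/
def rationalPlaces (F E : Type*) [Field F] [Field E] [Algebra F E] : Set (Place F E) :=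
  {P | P.degree = 1}

/-- `E = F(x, y)` is the function field of the Artin-Schreier curve `y ^ p - y = f(x)`,
with `x` transcendental over `F`. -/
structure IsArtinSchreierFunctionField {F E : Type*} [Field F] [Field E] [Algebra F E]
    (p : ℕ) (f : F[X]) (x y : E) : Prop where
  transcendental : Transcendental F x
  equation : y ^ p - y = Polynomial.aeval x f
  generates : IntermediateField.adjoin F {x, y} = ⊤

/-- The minimum distance of a linear code: the smallest Hamming weight of a nonzero codeword. -/
noncomputable def minDistance {k ι : Type*} [Field k] [DecidableEq k] [Fintype ι]
    (C : Submodule k (ι → k)) : ℕ :=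
  sInf {w | ∃ c ∈ C, c ≠ 0 ∧ hammingNorm c = w}

/-- The matrix with the `r` block rows `(α ^ i)`, `i = 1, …, r`, and columns indexed by the nonzero
elements `α` of `F`, where `α ^ i` is written as a column vector of length `m` over `𝔽_p` through
the isomorphism `φ`. -/
def powerMatrix {p m : ℕ} [Fact p.Prime] {F : Type*} [Field F] [Algebra (ZMod p) F]
    (φ : F ≃ₗ[ZMod p] (Fin m → ZMod p)) (r : ℕ) : Matrix (Fin r × Fin m) Fˣ (ZMod p) :=
  fun ij α => φ ((α : F) ^ ((ij.1 : ℕ) + 1)) ij.2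

/-- The linear code over `𝔽_p` of length `q - 1` generated by the rows of `powerMatrix φ r`. -/
def powerCode {p m : ℕ} [Fact p.Prime] {F : Type*} [Field F] [Algebra (ZMod p) F]
    (φ : F ≃ₗ[ZMod p] (Fin m → ZMod p)) (r : ℕ) : Submodule (ZMod p) (Fˣ → ZMod p) :=
  Submodule.span (ZMod p) (Set.range (powerMatrix φ r))

/-- The bound `1 + p (q - d)`, where `q = p ^ m` and `d` is the minimum distance of
`powerCode φ r`. -/
noncomputable def codeBound {p m : ℕ} [Fact p.Prime] {F : Type*} [Field F] [Fintype F]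
    [DecidableEq F] [Algebra (ZMod p) F] (φ : F ≃ₗ[ZMod p] (Fin m → ZMod p)) (r : ℕ) : ℤ :=
  1 + (p : ℤ) * ((p : ℤ) ^ m - (minDistance (powerCode φ r) : ℤ))

/-- The Serre bound `q + 1 + g ⌊2√q⌋` for a curve of genus `g = (r - 1)(p - 1) / 2`, the genus of
`y ^ p - y = f(x)` with `deg f = r` prime to `p`. -/
noncomputable def serreBound (p q r : ℕ) : ℝ :=
  (q : ℝ) + 1 + ((r : ℝ) - 1) * ((p : ℝ) - 1) / 2 * (⌊2 * Real.sqrt (q : ℝ)⌋ : ℝ)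

/-! By nondegeneracy of the trace form, the codewords are exactly the words `Tr (b x² + a x)` with
`x` running over the nonzero elements (`mem_powerCode_two_iff`). Since such a function vanishes at
`0`, its weight is `q` minus its number of zeros on all of `F`, so `q - d` is the largest number of
zeros of a nonzero codeword. By additive Hilbert 90, `y ^ p - y = f(a)` has `p` solutions if `Tr
f(a) = 0` and none otherwise. The curve is smooth at its affine points and has one rational place at
infinity, so `N(E_f) = 1 + p · #{a | Tr f(a) = 0}`
(`IsArtinSchreierFunctionField.ncard_rationalPlaces`). Bound and code thus concern the same zero
counts, except that `f` may have a constant term.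

After completing the square, orthogonality of characters expresses the count through quadratic Gauss
sums, whose squares are known. The remaining sign depends only on `F`, and both signs are realised
by varying `b` or the constant (`card_trace_quadratic_of_even`, `card_trace_quadratic_of_odd`). The
maximum is already attained with constant term zero (`exists_traceZeros_eq`), so the constant term
of `f` gains nothing and the bound is sharp.

Places are handled by valuations. At a pole of `x`, the monomials `x^i y^j` with `j < p` have
distinct pole orders `p i + 2 j`, which determines the valuation ring at infinity. At an affine
point the local ring is Noetherian with maximal ideal generated by `x - a`, hence a valuation ring.
-/

/-! ### Gauss sums and zeros of traces of quadratic polynomials -/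

section CharacterSums

variable {p m : ℕ} [Fact p.Prime] {F : Type*} [Field F] [Algebra (ZMod p) F]

/-- The additive character `exp (2πi Tr(·) / p)` of a finite field of characteristic `p`. -/
noncomputable def traceChar (p : ℕ) [Fact p.Prime] (F : Type*) [Field F] [Algebra (ZMod p) F] :
    AddChar F ℂ :=
  (ZMod.stdAddChar (N := p)).compAddMonoidHom (Algebra.trace (ZMod p) F).toAddMonoidHom

/-- The quadratic character of a finite field with complex values. -/
noncomputable def complexQuadraticChar (F : Type*) [Field F] [Fintype F] [DecidableEq F] :
    MulChar F ℂ :=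
  (quadraticChar F).ringHomComp (Int.castRingHom ℂ)

theorem traceChar_apply (a : F) :
    traceChar p F a = ZMod.stdAddChar (N := p) (Algebra.trace (ZMod p) F a) := rfl

theorem traceChar_algebraMap_mul (l : ZMod p) (a : F) :
    traceChar p F (algebraMap (ZMod p) F l * a) =
      ZMod.stdAddChar (N := p) (l * Algebra.trace (ZMod p) F a) := by
  rw [traceChar_apply, ← Algebra.smul_def, map_smul, smul_eq_mul]

theorem exists_trace_ne_zero [Fintype F] : ∃ a : F, Algebra.trace (ZMod p) F a ≠ 0 := by
  have h := Algebra.trace_ne_zero (ZMod p) F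
  by_contra! h'
  exact h (LinearMap.ext h')

theorem isPrimitive_traceChar [Fintype F] : (traceChar p F).IsPrimitive := by
  apply AddChar.IsPrimitive.of_ne_one
  obtain ⟨a, ha⟩ := exists_trace_ne_zero (p := p) (F := F)
  intro h
  have h1 := DFunLike.congr_fun h a
  rw [traceChar_apply, AddChar.one_apply] at h1
  exact ha ((ZMod.isPrimitive_stdAddChar p).zmod_char_eq_one_iff p _ |>.1 h1)

theorem ringChar_ne_two_of_algebra (hp : p ≠ 2) : ringChar F ≠ 2 := by
  have : CharP F p := charP_of_injective_algebraMap' (ZMod p) p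
  rwa [ringChar.eq F p]

theorem complexQuadraticChar_apply {F : Type*} [Field F] [Fintype F] [DecidableEq F] (a : F) :
    complexQuadraticChar F a = (quadraticChar F a : ℂ) := rfl

theorem complexQuadraticChar_ne_one {F : Type*} [Field F] [Fintype F] [DecidableEq F]
    (hF : ringChar F ≠ 2) : complexQuadraticChar F ≠ 1 := by
  unfold complexQuadraticChar
  rw [MulChar.ringHomComp_ne_one_iff (RingHom.injective_int _)]
  exact quadraticChar_ne_one hF

theorem isQuadratic_complexQuadraticChar {F : Type*} [Field F] [Fintype F] [DecidableEq F] :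
    (complexQuadraticChar F).IsQuadratic :=
  (quadraticChar_isQuadratic F).comp _

/-- The number of square roots of `y` is `1 + χ(y)`. The constant part sums to zero because `ψ` is
primitive, and scaling by `b` takes out the factor `χ(b)⁻¹ = χ(b)`. -/
theorem sum_addChar_mul_sq {F : Type*} [Field F] [Fintype F] [DecidableEq F] (hF : ringChar F ≠ 2)
    {ψ : AddChar F ℂ} (hψ : ψ.IsPrimitive) {b : F}
    (hb : b ≠ 0) :
    ∑ x, ψ (b * x ^ 2) = quadraticChar F b * gaussSum (complexQuadraticChar F) ψ := by
  have h1 : ∑ x, ψ (b * x ^ 2) = ∑ y, ((1 : ℂ) + quadraticChar F y) * ψ (b * y) := by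
    rw [← Finset.sum_fiberwise (s := Finset.univ) (g := fun x : F => x ^ 2)]
    refine Finset.sum_congr rfl fun y _ => ?_
    rw [Finset.sum_congr rfl (g := fun _ => ψ (b * y))
      (fun x hx => by rw [(Finset.mem_filter.1 hx).2]), Finset.sum_const, nsmul_eq_mul]
    congr 1
    have h := quadraticChar_card_sqrts hF y
    have e : {x : F | x ^ 2 = y}.toFinset = Finset.univ.filter (fun x : F => x ^ 2 = y) := by
      ext; simp
    rw [e] at h
    rw [← Int.cast_natCast, h]
    push_cast; ring
  have h2 : ∑ y, ψ (b * y) = 0 :=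
    AddChar.sum_eq_zero_of_ne_one (ψ := ψ.mulShift b) (hψ hb)
  have h3 := gaussSum_mulShift_eq (complexQuadraticChar F) ψ (Units.mk0 b hb)
  rw [isQuadratic_complexQuadraticChar.inv] at h3
  simp only [gaussSum, Units.val_mk0, AddChar.mulShift_apply, complexQuadraticChar_apply] at h3
  rw [h1]
  simp only [add_mul, one_mul, Finset.sum_add_distrib, h2, zero_add]
  rw [h3]; rfl

/-- Orthogonality: the sum over `l` of the characters of `l * Tr (g a)` is `p` when the trace
vanishes and `0` otherwise. -/
theorem card_trace_eq_zero_mul [Fintype F] (g : F → F) :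
    (p : ℂ) * (Finset.univ.filter fun a => Algebra.trace (ZMod p) F (g a) = 0).card =
      ∑ l : ZMod p, ∑ a, traceChar p F (algebraMap (ZMod p) F l * g a) := by
  rw [Finset.sum_comm]
  simp only [traceChar_algebraMap_mul]
  have h (a : F) := AddChar.sum_mulShift (Algebra.trace (ZMod p) F (g a))
    (ZMod.isPrimitive_stdAddChar p)
  simp only [h, ZMod.card, Nat.cast_ite, Nat.cast_zero]
  rw [Finset.sum_ite, Finset.sum_const_zero, add_zero, Finset.sum_const, nsmul_eq_mul, mul_comm]

/-- The exponent `(p^m - 1)/2` is `(p - 1)/2` times `1 + p + ⋯ + p^(m-1)`, and raising to the power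
`p` is trivial on the prime field. -/
theorem ZMod.pow_pow_div_two (hp : p ≠ 2) (l : ZMod p) (m : ℕ) :
    l ^ (p ^ m / 2) = (l ^ (p / 2)) ^ m := by
  have hodd : p % 2 = 1 := (Fact.out : p.Prime).eq_two_or_odd.resolve_left hp
  induction m with
  | zero => simp
  | succ n ih =>
    have h : p ^ (n + 1) / 2 = p * (p ^ n / 2) + p / 2 := by
      have h1 : p ^ n % 2 = 1 := by rw [Nat.pow_mod, hodd]; simp
      have h2 : p ^ n = 2 * (p ^ n / 2) + 1 := by omega
      have h3 : p ^ (n + 1) = 2 * (p * (p ^ n / 2)) + p := by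
        rw [pow_succ]; conv_lhs => rw [h2]
        ring
      omega
    rw [h, pow_add, pow_mul, ZMod.pow_card, ih, pow_succ]

/-- Euler's criterion in both fields gives the equality inside `F`, where the signs `1` and `-1`
remain distinct. This is the source of the dependence on the parity of `m`. -/
theorem quadraticChar_algebraMap [Fintype F] [DecidableEq F] (hp : p ≠ 2)
    (hq : Fintype.card F = p ^ m) {l : ZMod p}
    (hl : l ≠ 0) :
    quadraticChar F (algebraMap (ZMod p) F l) = quadraticChar (ZMod p) l ^ m := by
  have hF : ringChar F ≠ 2 := ringChar_ne_two_of_algebra hp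
  have hl' : algebraMap (ZMod p) F l ≠ 0 := by simpa using hl
  have h1 := quadraticChar_eq_pow_of_char_ne_two' hF (algebraMap (ZMod p) F l)
  have h2 := quadraticChar_eq_pow_of_char_ne_two' (F := ZMod p) (by rwa [ZMod.ringChar_zmod_n]) l
  rw [ZMod.card p] at h2
  rw [hq, ← map_pow, ZMod.pow_pow_div_two hp, ← h2] at h1
  have h3 : ((quadraticChar F (algebraMap (ZMod p) F l) : ℤ) : F) =
      ((quadraticChar (ZMod p) l ^ m : ℤ) : F) := by
    rw [h1]; push_cast; simp
  have key : (-1 : F) ≠ 1 := Ring.neg_one_ne_one_of_char_ne_two hF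
  have h4 : quadraticChar (ZMod p) l ^ m = 1 ∨ quadraticChar (ZMod p) l ^ m = -1 := by
    rcases quadraticChar_dichotomy hl with h | h <;> rw [h]
    · simp
    · exact neg_one_pow_eq_or ℤ m
  rcases quadraticChar_dichotomy hl' with h | h <;> rcases h4 with h' | h' <;>
    rw [h, h'] at h3 ⊢ <;> push_cast at h3
  · exact absurd h3.symm key
  · exact absurd h3 key

theorem card_trace_quadratic_eq_zero_mul [Fintype F] [DecidableEq F] (hp : p ≠ 2)
    (hq : Fintype.card F = p ^ m) {b : F}
    (hb : b ≠ 0) (c : F) :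
    (p : ℂ) * (Finset.univ.filter fun a => Algebra.trace (ZMod p) F (b * a ^ 2 + c) = 0).card =
      (p : ℂ) ^ m + quadraticChar F b * gaussSum (complexQuadraticChar F) (traceChar p F) *
        ∑ l ∈ Finset.univ.erase (0 : ZMod p), (quadraticChar (ZMod p) l : ℂ) ^ m *
          ZMod.stdAddChar (N := p) (l * Algebra.trace (ZMod p) F c) := by
  rw [card_trace_eq_zero_mul, ← Finset.add_sum_erase _ _ (Finset.mem_univ (0 : ZMod p)),
    Finset.mul_sum]
  congr 1
  · simp [hq]
  refine Finset.sum_congr rfl fun l hl => ?_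
  have hl0 := Finset.ne_of_mem_erase hl
  have hl' : algebraMap (ZMod p) F l ≠ 0 := by simpa using hl0
  rw [Finset.sum_congr rfl (g := fun a => traceChar p F (algebraMap (ZMod p) F l * b * a ^ 2) *
    ZMod.stdAddChar (N := p) (l * Algebra.trace (ZMod p) F c)) (fun a _ => by
      rw [mul_add, AddChar.map_add_eq_mul, ← mul_assoc, traceChar_algebraMap_mul l c]),
    ← Finset.sum_mul, sum_addChar_mul_sq (ringChar_ne_two_of_algebra hp) isPrimitive_traceChar
      (mul_ne_zero hl' hb), map_mul, quadraticChar_algebraMap hp hq hl0]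
  push_cast; ring

theorem gaussSum_complexQuadraticChar_traceChar_sq [Fintype F] [DecidableEq F] (hp : p ≠ 2)
    (hq : Fintype.card F = p ^ m) :
    gaussSum (complexQuadraticChar F) (traceChar p F) ^ 2 =
      (quadraticChar (ZMod p) (-1) : ℂ) ^ m * (p : ℂ) ^ m := by
  rw [gaussSum_sq (complexQuadraticChar_ne_one (ringChar_ne_two_of_algebra hp))
    isQuadratic_complexQuadraticChar isPrimitive_traceChar, hq, complexQuadraticChar_apply]
  have := quadraticChar_algebraMap (F := F) hp hq (l := -1) (by simp)
  rw [map_neg, map_one] at this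
  rw [this]; push_cast; rfl

/-- The Gauss sum squares to `p ^ m`, so it is `± p ^ (m / 2)`. The quadratic character is trivial
on scalars `l`, leaving a full character sum without its term at `l = 0`. -/
theorem card_trace_quadratic_of_even [Fintype F] [DecidableEq F] (hp : p ≠ 2)
    (hq : Fintype.card F = p ^ m) (hm : Even m) :
    ∃ e : ℤ, (e = 1 ∨ e = -1) ∧ ∀ b c : F, b ≠ 0 →
      (p : ℤ) * (Finset.univ.filter fun a => Algebra.trace (ZMod p) F (b * a ^ 2 + c) = 0).card =
        (p : ℤ) ^ m + e * quadraticChar F b * (p : ℤ) ^ (m / 2) *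
          (if Algebra.trace (ZMod p) F c = 0 then (p : ℤ) - 1 else -1) := by
  have hG : gaussSum (complexQuadraticChar F) (traceChar p F) ^ 2 = ((p : ℂ) ^ (m / 2)) ^ 2 := by
    rw [gaussSum_complexQuadraticChar_traceChar_sq hp hq, ← pow_mul,
      Nat.div_mul_cancel hm.two_dvd]
    rcases quadraticChar_dichotomy (F := ZMod p) (a := -1) (by simp) with h | h <;>
      simp [h, hm.neg_one_pow]
  obtain ⟨e, he, hGe⟩ : ∃ e : ℤ, (e = 1 ∨ e = -1) ∧
      gaussSum (complexQuadraticChar F) (traceChar p F) = e * (p : ℂ) ^ (m / 2) := by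
    rcases sq_eq_sq_iff_eq_or_eq_neg.1 hG with h | h
    · exact ⟨1, Or.inl rfl, by simp [h]⟩
    · exact ⟨-1, Or.inr rfl, by simp [h]⟩
  refine ⟨e, he, fun b c hb => ?_⟩
  have h := card_trace_quadratic_eq_zero_mul hp hq hb c
  have hsum : ∑ l ∈ Finset.univ.erase (0 : ZMod p), (quadraticChar (ZMod p) l : ℂ) ^ m *
      ZMod.stdAddChar (N := p) (l * Algebra.trace (ZMod p) F c) =
      if Algebra.trace (ZMod p) F c = 0 then (p : ℂ) - 1 else -1 := by
    have h1 := AddChar.sum_mulShift (Algebra.trace (ZMod p) F c) (ZMod.isPrimitive_stdAddChar p)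
    rw [← Finset.add_sum_erase _ _ (Finset.mem_univ (0 : ZMod p)), zero_mul,
      AddChar.map_zero_eq_one, ZMod.card] at h1
    rw [Finset.sum_congr rfl (g := fun l : ZMod p =>
      ZMod.stdAddChar (N := p) (l * Algebra.trace (ZMod p) F c))]
    · rw [← eq_sub_iff_add_eq'] at h1
      rw [h1]; split_ifs <;> simp
    · intro l hl
      rcases quadraticChar_dichotomy (Finset.ne_of_mem_erase hl) with h | h <;>
        simp [h, hm.neg_one_pow]
  rw [hsum, hGe] at h
  rw [← Int.cast_inj (α := ℂ)]
  push_cast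
  rw [h]
  ring

/-- The sum over scalars is now a Gauss sum of the prime field, twisted by `Tr c`. Its product with
the Gauss sum of `F` squares to `p ^ (m + 1)` because the factors `χ(-1)` cancel; only the sign of
this product is left unknown. -/
theorem card_trace_quadratic_of_odd [Fintype F] [DecidableEq F] (hp : p ≠ 2)
    (hq : Fintype.card F = p ^ m) (hm : Odd m) :
    ∃ e : ℤ, (e = 1 ∨ e = -1) ∧ ∀ b c : F, b ≠ 0 →
      (p : ℤ) * (Finset.univ.filter fun a => Algebra.trace (ZMod p) F (b * a ^ 2 + c) = 0).card =
        (p : ℤ) ^ m + e * quadraticChar F b * (p : ℤ) ^ ((m + 1) / 2) *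
          quadraticChar (ZMod p) (Algebra.trace (ZMod p) F c) := by
  have hpc : ringChar (ZMod p) ≠ 2 := by rwa [ZMod.ringChar_zmod_n]
  have hG : (gaussSum (complexQuadraticChar F) (traceChar p F) *
      gaussSum (complexQuadraticChar (ZMod p)) (ZMod.stdAddChar (N := p))) ^ 2 =
      ((p : ℂ) ^ ((m + 1) / 2)) ^ 2 := by
    rw [mul_pow, gaussSum_complexQuadraticChar_traceChar_sq hp hq,
      gaussSum_sq (complexQuadraticChar_ne_one hpc) isQuadratic_complexQuadraticChar
        (ZMod.isPrimitive_stdAddChar p), ← pow_mul, Nat.div_mul_cancel hm.add_one.two_dvd,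
      complexQuadraticChar_apply, ZMod.card, pow_succ (p : ℂ)]
    rcases quadraticChar_dichotomy (F := ZMod p) (a := -1) (by simp) with h | h <;>
      simp [h, hm.neg_one_pow]
  obtain ⟨e, he, hGe⟩ : ∃ e : ℤ, (e = 1 ∨ e = -1) ∧
      gaussSum (complexQuadraticChar F) (traceChar p F) *
        gaussSum (complexQuadraticChar (ZMod p)) (ZMod.stdAddChar (N := p)) =
        e * (p : ℂ) ^ ((m + 1) / 2) := by
    rcases sq_eq_sq_iff_eq_or_eq_neg.1 hG with h | h
    · exact ⟨1, Or.inl rfl, by simp [h]⟩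
    · exact ⟨-1, Or.inr rfl, by simp [h]⟩
  refine ⟨e, he, fun b c hb => ?_⟩
  have h := card_trace_quadratic_eq_zero_mul hp hq hb c
  have hsum : ∑ l ∈ Finset.univ.erase (0 : ZMod p), (quadraticChar (ZMod p) l : ℂ) ^ m *
      ZMod.stdAddChar (N := p) (l * Algebra.trace (ZMod p) F c) =
      quadraticChar (ZMod p) (Algebra.trace (ZMod p) F c) *
        gaussSum (complexQuadraticChar (ZMod p)) (ZMod.stdAddChar (N := p)) := by
    have h0 : ∑ l ∈ Finset.univ.erase (0 : ZMod p), (quadraticChar (ZMod p) l : ℂ) ^ m *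
        ZMod.stdAddChar (N := p) (l * Algebra.trace (ZMod p) F c) =
        gaussSum (complexQuadraticChar (ZMod p))
          ((ZMod.stdAddChar (N := p)).mulShift (Algebra.trace (ZMod p) F c)) := by
      rw [gaussSum, ← Finset.add_sum_erase _ _ (Finset.mem_univ (0 : ZMod p)),
        MulChar.map_zero, zero_mul, zero_add]
      refine Finset.sum_congr rfl fun l hl => ?_
      rw [AddChar.mulShift_apply, mul_comm l, complexQuadraticChar_apply]
      rcases quadraticChar_dichotomy (Finset.ne_of_mem_erase hl) with h | h <;>
        simp [h, hm.neg_one_pow]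
    rw [h0]
    by_cases ht : Algebra.trace (ZMod p) F c = 0
    · rw [ht, AddChar.mulShift_zero, gaussSum_one_right (complexQuadraticChar_ne_one hpc)]
      simp
    · have := gaussSum_mulShift_eq (complexQuadraticChar (ZMod p)) (ZMod.stdAddChar (N := p))
        (Units.mk0 _ ht)
      rw [isQuadratic_complexQuadraticChar.inv] at this
      exact this
  rw [hsum] at h
  rw [← Int.cast_inj (α := ℂ)]
  push_cast
  rw [h]
  linear_combination (quadraticChar F b : ℂ) *
    (quadraticChar (ZMod p) (Algebra.trace (ZMod p) F c) : ℂ) * hGe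

end CharacterSums

/-! ### Maximal zero counts -/

section ExtremalCounts

variable {p m : ℕ} [Fact p.Prime] {F : Type*} [Field F] [Fintype F]
  [Algebra (ZMod p) F]

/-- The largest deviation from `p ^ m` of the number of affine points of `y ^ p - y = f(x)` with
`deg f = 2` over the field with `p ^ m` elements. -/
def quadraticExcess (p m : ℕ) : ℤ :=
  if Even m then ((p : ℤ) - 1) * (p : ℤ) ^ (m / 2) else (p : ℤ) ^ ((m + 1) / 2)

/-- The number of `x` with `Tr (b x² + a x + c) = 0`. -/
noncomputable def traceZeros (p : ℕ) [Fact p.Prime] {F : Type*} [Field F] [Fintype F] [Algebra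
    (ZMod p) F]
    (b a c : F) : ℕ :=
  (Finset.univ.filter fun x => Algebra.trace (ZMod p) F (b * x ^ 2 + a * x + c) = 0).card

theorem quadraticExcess_pos (p m : ℕ) [hp : Fact p.Prime] : 0 < quadraticExcess p m := by
  have h : (1 : ℤ) < p := by exact_mod_cast hp.out.one_lt
  unfold quadraticExcess
  split_ifs
  · exact mul_pos (by omega) (by positivity)
  · positivity

theorem traceZeros_eq_complete_square (hp : p ≠ 2) {b : F} (hb : b ≠ 0) (a c : F) :
    traceZeros p b a c = (Finset.univ.filter fun x =>
      Algebra.trace (ZMod p) F (b * x ^ 2 + (c - b * (a / (2 * b)) ^ 2)) = 0).card := by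
  have h2 : (2 : F) ≠ 0 := Ring.two_ne_zero (ringChar_ne_two_of_algebra hp)
  unfold traceZeros
  refine Finset.card_equiv (Equiv.addRight (a / (2 * b))) fun x => ?_
  simp only [Finset.mem_filter, Finset.mem_univ, true_and, Equiv.coe_addRight]
  have : b * x ^ 2 + a * x + c =
      b * (x + a / (2 * b)) ^ 2 + (c - b * (a / (2 * b)) ^ 2) := by
    field_simp; ring
  rw [this]

theorem mul_traceZeros_le [DecidableEq F] (hp : p ≠ 2) (hq : Fintype.card F = p ^ m) {b : F}
    (hb : b ≠ 0)
    (a c : F) : (p : ℤ) * traceZeros p b a c ≤ (p : ℤ) ^ m + quadraticExcess p m := by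
  have h1 : (1 : ℤ) < p := by exact_mod_cast (Fact.out : p.Prime).one_lt
  rw [traceZeros_eq_complete_square hp hb]
  by_cases hm : Even m
  · obtain ⟨e, he, h⟩ := card_trace_quadratic_of_even (F := F) hp hq hm
    rw [h b _ hb, quadraticExcess, if_pos hm]
    have hP : (0 : ℤ) < (p : ℤ) ^ (m / 2) := by positivity
    rcases he with rfl | rfl <;> rcases quadraticChar_dichotomy hb with hb' | hb' <;>
      rw [hb'] <;> split_ifs <;> nlinarith
  · obtain ⟨e, he, h⟩ := card_trace_quadratic_of_odd (F := F) hp hq (Nat.not_even_iff_odd.1 hm)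
    rw [h b _ hb, quadraticExcess, if_neg hm]
    have hP : (0 : ℤ) < (p : ℤ) ^ ((m + 1) / 2) := by positivity
    have hχ := quadraticChar_isQuadratic (ZMod p)
      (Algebra.trace (ZMod p) F (c - b * (a / (2 * b)) ^ 2))
    rcases he with rfl | rfl <;> rcases quadraticChar_dichotomy hb with hb' | hb' <;>
      rcases hχ with ht | ht | ht <;> rw [hb', ht] <;> linarith

/-- The constant term must be `0` for the polynomial to give a codeword. For even `m` the sign is
adjusted by `b`; for odd `m`, by the constant that the linear term creates when the square is
completed. -/
theorem exists_traceZeros_eq [DecidableEq F] (hp : p ≠ 2) (hq : Fintype.card F = p ^ m) :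
    ∃ b a : F, b ≠ 0 ∧
      (p : ℤ) * traceZeros p b a 0 = (p : ℤ) ^ m + quadraticExcess p m := by
  have h1 : (1 : ℤ) < p := by exact_mod_cast (Fact.out : p.Prime).one_lt
  have hF : ringChar F ≠ 2 := ringChar_ne_two_of_algebra hp
  have h2 : (2 : F) ≠ 0 := Ring.two_ne_zero hF
  by_cases hm : Even m
  · obtain ⟨e, he, h⟩ := card_trace_quadratic_of_even (F := F) hp hq hm
    obtain ⟨b, hb, hbe⟩ : ∃ b : F, b ≠ 0 ∧ quadraticChar F b = e := by
      rcases he with rfl | rfl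
      · exact ⟨1, one_ne_zero, map_one _⟩
      · obtain ⟨b, hb⟩ := quadraticChar_exists_neg_one hF
        exact ⟨b, by rintro rfl; simp at hb, hb⟩
    refine ⟨b, 0, hb, ?_⟩
    rw [traceZeros_eq_complete_square hp hb, h b _ hb, hbe, quadraticExcess, if_pos hm]
    rcases he with rfl | rfl <;> simp [mul_comm]
  · have hmo := Nat.not_even_iff_odd.1 hm
    obtain ⟨e, he, h⟩ := card_trace_quadratic_of_odd (F := F) hp hq hmo
    obtain ⟨t, ht⟩ : ∃ t : ZMod p, quadraticChar (ZMod p) t = e := by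
      rcases he with rfl | rfl
      · exact ⟨1, map_one _⟩
      · exact quadraticChar_exists_neg_one (by rwa [ZMod.ringChar_zmod_n])
    obtain ⟨c, rfl⟩ : ∃ c : F, Algebra.trace (ZMod p) F c = t :=
      Algebra.trace_surjective (ZMod p) F t
    have hc := h 1 c one_ne_zero
    rw [ht, map_one] at hc
    have hee : e * e = 1 := by rcases he with rfl | rfl <;> rfl
    -- The count formula itself supplies the witness: as `e * e = 1`, there are `(p ^ m + p ^ ((m +
    -- 1) / 2)) / p > 0` solutions of `Tr (x²) = -Tr c`. For such an `x`, the polynomial `X² + 2 x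
    -- X` has completed constant `-x²`, of trace `Tr c`.
    have hpos : (Finset.univ.filter fun a : F =>
        Algebra.trace (ZMod p) F (1 * a ^ 2 + c) = 0).Nonempty := by
      rw [← Finset.card_pos]
      have : (0 : ℤ) < p ^ m + p ^ ((m + 1) / 2) := by positivity
      by_contra! h0
      rw [Nat.le_zero.1 h0] at hc
      push_cast at hc
      have h3 : (p : ℤ) ^ m + p ^ ((m + 1) / 2) = 0 := by
        linear_combination -hc - (p : ℤ) ^ ((m + 1) / 2) * hee
      exact this.ne' h3
    obtain ⟨x, hx⟩ := hpos
    simp only [Finset.mem_filter, Finset.mem_univ, true_and, one_mul, map_add] at hx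
    refine ⟨1, 2 * x, one_ne_zero, ?_⟩
    rw [traceZeros_eq_complete_square hp one_ne_zero, h 1 _ one_ne_zero, quadraticExcess,
      if_neg hm]
    have : Algebra.trace (ZMod p) F (0 - 1 * (2 * x / (2 * 1)) ^ 2) =
        Algebra.trace (ZMod p) F c := by
      rw [mul_one, mul_div_cancel_left₀ _ h2, zero_sub, one_mul, map_neg]
      linear_combination -hx
    rw [this, ht, map_one]
    linear_combination (p : ℤ) ^ ((m + 1) / 2) * hee

theorem mul_traceZeros_linear (hq : Fintype.card F = p ^ m) {a : F} (ha : a ≠ 0) :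
    (p : ℤ) * traceZeros p 0 a 0 = (p : ℤ) ^ m := by
  have h := card_trace_eq_zero_mul (p := p) fun x : F => a * x
  rw [← Finset.add_sum_erase _ _ (Finset.mem_univ (0 : ZMod p)),
    Finset.sum_eq_zero (s := Finset.univ.erase (0 : ZMod p))] at h
  · simp only [map_zero, zero_mul, AddChar.map_zero_eq_one, Finset.sum_const, Finset.card_univ,
      hq, nsmul_eq_mul, mul_one, add_zero] at h
    simp only [traceZeros, zero_mul, zero_add, add_zero]
    exact_mod_cast h
  · intro l hl
    have hl' : algebraMap (ZMod p) F l ≠ 0 := by simpa using Finset.ne_of_mem_erase hl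
    have := AddChar.sum_eq_zero_of_ne_one (ψ := (traceChar p F).mulShift (algebraMap _ _ l * a))
      (isPrimitive_traceChar (mul_ne_zero hl' ha))
    simpa [AddChar.mulShift_apply, mul_assoc] using this

end ExtremalCounts

/-! ### The code and its minimum distance -/

section Code

variable {p m : ℕ} [Fact p.Prime] {F : Type*} [Field F] [Fintype F]
  [Algebra (ZMod p) F]

theorem exists_trace_mul_eq {p : ℕ} [Fact p.Prime] {F : Type*} [Field F] [Fintype F]
    [Algebra (ZMod p) F] (l : F →ₗ[ZMod p] ZMod p) :
    ∃ a : F, ∀ x, l x = Algebra.trace (ZMod p) F (a * x) := by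
  obtain ⟨a, ha⟩ := ((Algebra.traceForm (ZMod p) F).toDual
    (traceForm_nondegenerate (ZMod p) F)).surjective l
  refine ⟨a, fun x => ?_⟩
  rw [← ha]
  rfl

/-- Each coordinate of `φ` is a functional `x ↦ Tr (a x)`, so rows are of this form. Conversely, `Tr
(c ·) ∘ φ⁻¹` is a combination of coordinate functionals, which writes `Tr (c x^i)` in terms of rows.
-/
theorem mem_powerCode_two_iff {p m : ℕ} [Fact p.Prime] {F : Type*} [Field F] [Fintype F]
    [Algebra (ZMod p) F] (φ : F ≃ₗ[ZMod p] (Fin m → ZMod p)) (w : Fˣ → ZMod p) :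
    w ∈ powerCode φ 2 ↔
      ∃ b a : F, ∀ x : Fˣ, w x = Algebra.trace (ZMod p) F (b * (x : F) ^ 2 + a * x) := by
  constructor
  · intro hw
    induction hw using Submodule.span_induction with
    | mem w hw =>
      obtain ⟨⟨i, j⟩, rfl⟩ := hw
      obtain ⟨a, ha⟩ := exists_trace_mul_eq ((LinearMap.proj j).comp φ.toLinearMap)
      have ha' (x : F) : φ x j = Algebra.trace (ZMod p) F (a * x) := ha x
      fin_cases i
      · exact ⟨0, a, fun x => by simp [powerMatrix, ha']⟩
      · exact ⟨a, 0, fun x => by simp [powerMatrix, ha']⟩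
    | zero => exact ⟨0, 0, fun x => by simp⟩
    | add u w _ _ hu hw =>
      obtain ⟨b, a, h⟩ := hu
      obtain ⟨b', a', h'⟩ := hw
      refine ⟨b + b', a + a', fun x => ?_⟩
      rw [Pi.add_apply, h, h', ← map_add]
      congr 1; ring
    | smul r w _ hw =>
      obtain ⟨b, a, h⟩ := hw
      refine ⟨r • b, r • a, fun x => ?_⟩
      rw [Pi.smul_apply, h, ← map_smul]
      congr 1; rw [smul_add, smul_mul_assoc, smul_mul_assoc]
  · rintro ⟨b, a, h⟩
    have key (c : F) (i : Fin 2) :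
        (fun x : Fˣ => Algebra.trace (ZMod p) F (c * (x : F) ^ ((i : ℕ) + 1))) ∈
          powerCode φ 2 := by
      let l : (Fin m → ZMod p) →ₗ[ZMod p] ZMod p :=
        (Algebra.trace (ZMod p) F ∘ₗ LinearMap.mulLeft (ZMod p) c) ∘ₗ φ.symm.toLinearMap
      have : (fun x : Fˣ => Algebra.trace (ZMod p) F (c * (x : F) ^ ((i : ℕ) + 1))) =
          ∑ j, l (Pi.single j 1) • powerMatrix φ 2 (i, j) := by
        funext x
        have h1 : Algebra.trace (ZMod p) F (c * (x : F) ^ ((i : ℕ) + 1)) =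
            l (φ ((x : F) ^ ((i : ℕ) + 1))) := by simp [l]
        rw [h1, LinearMap.pi_apply_eq_sum_univ l]
        simp only [Finset.sum_apply, Pi.smul_apply, powerMatrix, smul_eq_mul]
        refine Finset.sum_congr rfl fun j _ => ?_
        rw [mul_comm]
        congr 2
        ext k; simp [Pi.single_apply, eq_comm]
      rw [this]
      exact Submodule.sum_mem _ fun j _ => Submodule.smul_mem _ _
        (Submodule.subset_span ⟨(i, j), rfl⟩)
    have : w = (fun x : Fˣ => Algebra.trace (ZMod p) F (b * (x : F) ^ (((1 : Fin 2) : ℕ) + 1))) +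
        fun x : Fˣ => Algebra.trace (ZMod p) F (a * (x : F) ^ (((0 : Fin 2) : ℕ) + 1)) := by
      funext x; simp [h]
    rw [this]
    exact Submodule.add_mem _ (key b 1) (key a 0)

/-- The zero at `0` is not a coordinate of the word, so the total is `q` and not the code length `q
- 1`. -/
theorem hammingNorm_add_card_zeros {F : Type*} [Field F] [Fintype F] [DecidableEq F] {k : Type*}
    [Field k] [DecidableEq k] (g : F → k)
    (hg : g 0 = 0) :
    hammingNorm (fun x : Fˣ => g x) + (Finset.univ.filter fun x => g x = 0).card =
      Fintype.card F := by
  have h := Finset.card_filter_add_card_filter_not (s := Finset.univ) (fun x : F => g x = 0)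
  rw [Finset.card_univ] at h
  rw [← h, add_comm]
  congr 1
  unfold hammingNorm
  refine Finset.card_bij (fun x _ => (x : F)) (fun x hx => by simpa using hx)
    (fun x _ y _ h => Units.ext h) ?_
  intro y hy
  have hy' : g y ≠ 0 := by simpa using hy
  have hy0 : y ≠ 0 := by rintro rfl; exact hy' hg
  exact ⟨Units.mk0 y hy0, by simpa using hy', rfl⟩

theorem one_le_exponent {p m : ℕ} {F : Type*} [Field F] [Fintype F] (hq : Fintype.card F = p ^ m) :
    1 ≤ m := by
  by_contra! h
  have h1 := Fintype.one_lt_card (α := F)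
  rw [hq, Nat.lt_one_iff.1 h, pow_zero] at h1
  exact lt_irrefl _ h1

/-- Strictness shows that an extremal polynomial does not vanish identically, so its codeword is
nonzero. -/
theorem quadraticExcess_lt (hp : p ≠ 2) (hm : 1 ≤ m) :
    (p : ℤ) ^ m + quadraticExcess p m < p * (p : ℤ) ^ m := by
  have h2 := (Fact.out : p.Prime).two_le
  have h3 : (3 : ℤ) ≤ p := by omega
  have hP : (0 : ℤ) < (p : ℤ) ^ m := by positivity
  unfold quadraticExcess
  split_ifs with he
  · have : (p : ℤ) ^ (m / 2) < (p : ℤ) ^ m := pow_lt_pow_right₀ (by omega) (by omega)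
    nlinarith
  · have : (p : ℤ) ^ ((m + 1) / 2) ≤ (p : ℤ) ^ m := pow_le_pow_right₀ (by omega) (by omega)
    nlinarith

theorem codeBound_two_eq [DecidableEq F] (hp : p ≠ 2) (hq : Fintype.card F = p ^ m)
    (φ : F ≃ₗ[ZMod p] (Fin m → ZMod p)) :
    codeBound φ 2 = (p : ℤ) ^ m + 1 + quadraticExcess p m := by
  have hp0 : (0 : ℤ) < p := by exact_mod_cast (Fact.out : p.Prime).pos
  have hq' : (Fintype.card F : ℤ) = (p : ℤ) ^ m := by exact_mod_cast hq
  have weight (b a : F) : (hammingNorm fun x : Fˣ =>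
      Algebra.trace (ZMod p) F (b * (x : F) ^ 2 + a * x)) + traceZeros p b a 0 =
      Fintype.card F := by
    simpa only [traceZeros, add_zero] using hammingNorm_add_card_zeros
      (fun x : F => Algebra.trace (ZMod p) F (b * x ^ 2 + a * x)) (by simp)
  obtain ⟨b, a, hb, hba⟩ := exists_traceZeros_eq (F := F) hp hq
  have hmin : minDistance (powerCode φ 2) = hammingNorm fun x : Fˣ =>
      Algebra.trace (ZMod p) F (b * (x : F) ^ 2 + a * x) := by
    refine IsLeast.csInf_eq ⟨⟨_, (mem_powerCode_two_iff φ _).2 ⟨b, a, fun _ => rfl⟩, ?_, rfl⟩, ?_⟩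
    · intro h0
      have h1 := weight b a
      rw [h0, hammingNorm_zero, zero_add] at h1
      rw [h1, hq'] at hba
      exact (quadraticExcess_lt hp (one_le_exponent hq)).ne' hba
    · rintro _ ⟨w, hw, hw0, rfl⟩
      obtain ⟨b', a', h⟩ := (mem_powerCode_two_iff φ _).1 hw
      obtain rfl := funext h
      have hle : (p : ℤ) * traceZeros p b' a' 0 ≤ p * traceZeros p b a 0 := by
        rw [hba]
        -- Words without quadratic part are balanced, with exactly `q / p` zeros; this is fewer than
        -- the extremal count since the excess is positive.
        by_cases hb' : b' = 0
        · subst hb'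
          have ha' : a' ≠ 0 := by
            rintro rfl
            exact hw0 (by funext x; simp)
          rw [mul_traceZeros_linear hq ha']
          linarith [quadraticExcess_pos p m]
        · exact mul_traceZeros_le hp hq hb' a' 0
      have hle' : traceZeros p b' a' 0 ≤ traceZeros p b a 0 := by
        exact_mod_cast le_of_mul_le_mul_left hle hp0
      have := weight b a
      have := weight b' a'
      omega
  have h := weight b a
  rw [← hmin] at h
  have h' : (minDistance (powerCode φ 2) : ℤ) + traceZeros p b a 0 = (p : ℤ) ^ m := by
    rw [← hq', ← h]; push_cast; rfl
  unfold codeBound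
  linear_combination hba - p * h'

end Code

/-! ### Additive Hilbert 90 and affine points -/

section ArtinSchreierMap

variable {p : ℕ} [Fact p.Prime] {F : Type*} [Field F] [Fintype F] [Algebra (ZMod p) F]

/-- The map `b ↦ b ^ p - b` as a linear map over the prime field. -/
noncomputable def artinSchreierMap (p : ℕ) [Fact p.Prime] (F : Type*) [Field F]
    [Algebra (ZMod p) F] : F →ₗ[ZMod p] F :=
  (FiniteField.frobeniusAlgHom (ZMod p) F).toLinearMap - LinearMap.id

theorem artinSchreierMap_apply {F : Type*} [Field F] [Algebra (ZMod p) F] (b : F) :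
    artinSchreierMap p F b = b ^ p - b := by
  simp [artinSchreierMap, ZMod.card]

theorem card_ker_artinSchreierMap :
    Nat.card (LinearMap.ker (artinSchreierMap p F)) = p := by
  have : CharP F p := charP_of_injective_algebraMap' (ZMod p) p
  have h : (LinearMap.ker (artinSchreierMap p F) : Set F) = ((⊥ : Subfield F) : Set F) := by
    ext x
    simp [artinSchreierMap_apply, Subfield.mem_bot_iff_pow_eq_self F p, sub_eq_zero]
  calc Nat.card (LinearMap.ker (artinSchreierMap p F))
      = Nat.card ((⊥ : Subfield F)) := Nat.card_congr (Equiv.setCongr h)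
    _ = p := Subfield.card_bot F p

/-- The trace is Frobenius-invariant, which gives one inclusion. The kernel of `b ↦ b ^ p - b` is
the prime field, so both sides have codimension one. -/
theorem range_artinSchreierMap :
    LinearMap.range (artinSchreierMap p F) = LinearMap.ker (Algebra.trace (ZMod p) F) := by
  apply Submodule.eq_of_le_of_finrank_eq
  · rintro _ ⟨b, rfl⟩
    rw [LinearMap.mem_ker, artinSchreierMap_apply, map_sub, sub_eq_zero]
    have := Algebra.trace_eq_of_algEquiv
      (FiniteField.frobeniusAlgEquivOfAlgebraic (ZMod p) F) b
    simpa [FiniteField.coe_frobeniusAlgEquivOfAlgebraic, ZMod.card] using this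
  · have h1 := LinearMap.finrank_range_add_finrank_ker (artinSchreierMap p F)
    have h2 := LinearMap.finrank_range_add_finrank_ker (Algebra.trace (ZMod p) F)
    rw [LinearMap.range_eq_top.2 (Algebra.trace_surjective (ZMod p) F), finrank_top,
      Module.finrank_self] at h2
    have h3 : Module.finrank (ZMod p) (LinearMap.ker (artinSchreierMap p F)) = 1 := by
      have h4 := Module.natCard_eq_pow_finrank (K := ZMod p)
        (V := LinearMap.ker (artinSchreierMap p F))
      rw [card_ker_artinSchreierMap, Nat.card_zmod] at h4
      exact (Nat.pow_right_injective (Fact.out : p.Prime).two_le (by simpa using h4)).symm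
    omega

theorem card_artinSchreier_fiber [DecidableEq F] (c : F) :
    (Finset.univ.filter fun b : F => b ^ p - b = c).card =
      if Algebra.trace (ZMod p) F c = 0 then p else 0 := by
  split_ifs with h
  · obtain ⟨b₀, hb₀⟩ : c ∈ LinearMap.range (artinSchreierMap p F) := by
      rw [range_artinSchreierMap]; exact h
    refine Eq.trans ?_ (card_ker_artinSchreierMap (p := p) (F := F))
    rw [← Fintype.card_subtype, ← Nat.card_eq_fintype_card]
    refine Nat.card_congr ((Equiv.subRight b₀).subtypeEquiv fun b => ?_)
    rw [Equiv.subRight_apply, LinearMap.mem_ker, map_sub, hb₀, artinSchreierMap_apply, sub_eq_zero]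
  · rw [Finset.card_eq_zero, Finset.filter_eq_empty_iff]
    intro b _ hb
    apply h
    rw [← artinSchreierMap_apply] at hb
    have : c ∈ LinearMap.range (artinSchreierMap p F) := ⟨b, hb⟩
    rwa [range_artinSchreierMap] at this

/-- The affine rational points of the curve `y ^ p - y = f(x)`. -/
def affinePoints (p : ℕ) {F : Type*} [Field F] (f : F[X]) : Set (F × F) :=
  {P | P.2 ^ p - P.2 = f.eval P.1}

theorem ncard_affinePoints (f : F[X]) :
    (affinePoints p f).ncard =
      p * (Finset.univ.filter fun a => Algebra.trace (ZMod p) F (f.eval a) = 0).card := by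
  classical
  have h : affinePoints p f = ((Finset.univ.filter fun P : F × F =>
      P.2 ^ p - P.2 = f.eval P.1 : Finset (F × F)) : Set (F × F)) := by
    ext; simp [affinePoints]
  rw [h, Set.ncard_coe_finset, ← Finset.univ_product_univ, Finset.card_filter,
    Finset.sum_product]
  rw [Finset.sum_congr rfl fun a _ => (Finset.card_filter _ _).symm.trans
    (card_artinSchreier_fiber (f.eval a)), Finset.sum_ite, Finset.sum_const_zero, add_zero,
    Finset.sum_const, smul_eq_mul, mul_comm]

end ArtinSchreierMap

/-! ### Valuations at places -/

namespace Place

variable {F E : Type*} [Field F] [Field E] [Algebra F E]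

theorem ext_ring {P Q : Place F E} (h : P.ring = Q.ring) : P = Q := by
  cases P; cases Q; cases h; rfl

theorem valuation_algebraMap (P : Place F E) {c : F} (hc : c ≠ 0) :
    P.ring.valuation (algebraMap F E c) = 1 := by
  refine le_antisymm ((P.ring.valuation_le_one_iff _).2 (P.algebraMap_mem c)) ?_
  have h := (P.ring.valuation_le_one_iff _).2 (P.algebraMap_mem c⁻¹)
  have hc' : P.ring.valuation (algebraMap F E c) ≠ 0 := by simpa using hc
  rwa [map_inv₀, map_inv₀, inv_le_one₀ (zero_lt_iff.2 hc')] at h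

theorem algebraMap_mem_nonunits_iff (P : Place F E) {c : F} :
    algebraMap F E c ∈ P.ring.nonunits ↔ c = 0 := by
  rw [ValuationSubring.mem_nonunits_iff]
  constructor
  · intro h
    by_contra hc
    exact h.ne (P.valuation_algebraMap hc)
  · rintro rfl; simp

theorem degree_eq_one_iff (P : Place F E) :
    P.degree = 1 ↔ ∀ z ∈ P.ring, ∃ c : F, z - algebraMap F E c ∈ P.ring.nonunits := by
  have key (z : P.ring) (c : F) : (z : E) - algebraMap F E c ∈ P.ring.nonunits ↔
      algebraMap F (IsLocalRing.ResidueField P.ring) c = IsLocalRing.residue P.ring z := by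
    have h1 : (z : E) - algebraMap F E c = ((z - algebraMap F P.ring c : P.ring) : E) := rfl
    rw [h1, ValuationSubring.coe_mem_nonunits_iff, ← IsLocalRing.residue_eq_zero_iff, map_sub,
      sub_eq_zero, eq_comm]
    rfl
  unfold degree
  constructor
  · intro h z hz
    have hsurj := (Algebra.finrank_eq_one_iff_bijective_algebraMap.1 h).2
    obtain ⟨c, hc⟩ := hsurj (IsLocalRing.residue P.ring ⟨z, hz⟩)
    exact ⟨c, (key ⟨z, hz⟩ c).2 hc⟩
  · intro h
    have hsurj : Function.Surjective (algebraMap F (IsLocalRing.ResidueField P.ring)) := by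
      intro r
      obtain ⟨z, rfl⟩ := IsLocalRing.residue_surjective r
      obtain ⟨c, hc⟩ := h z z.2
      exact ⟨c, (key z c).1 hc⟩
    exact Algebra.finrank_eq_one_iff_bijective_algebraMap.2
      ⟨(algebraMap F (IsLocalRing.ResidueField P.ring)).injective, hsurj⟩

theorem one_lt_valuation (P : Place F E) {x : E} (hx : x ∉ P.ring) : 1 < P.ring.valuation x := by
  rwa [← not_le, P.ring.valuation_le_one_iff]

/-- Valuations are multiplicative, so a pole of `x` means value greater than `1`. Nonzero constants
have value `1`, hence the top power of `x` dominates. -/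
theorem valuation_aeval_sub_lt (P : Place F E) {x : E} (hx : x ∉ P.ring) (g : F[X]) :
    P.ring.valuation (Polynomial.aeval x g - algebraMap F E g.leadingCoeff * x ^ g.natDegree) <
      P.ring.valuation x ^ g.natDegree := by
  have hx1 := P.one_lt_valuation hx
  have h : Polynomial.aeval x g - algebraMap F E g.leadingCoeff * x ^ g.natDegree =
      Polynomial.aeval x g.eraseLead := by
    rw [sub_eq_iff_eq_add]
    have h1 := congrArg (Polynomial.aeval x) g.eraseLead_add_C_mul_X_pow
    rw [map_add, map_mul, Polynomial.aeval_C, map_pow, Polynomial.aeval_X] at h1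
    exact h1.symm
  rw [h, Polynomial.aeval_eq_sum_range' (n := g.natDegree + 1)
    (Nat.lt_succ_of_le (g.eraseLead_natDegree_le_aux))]
  refine Valuation.map_sum_lt _ (pow_ne_zero _ (zero_lt_one.trans hx1).ne') fun i hi => ?_
  by_cases hi' : g.eraseLead.coeff i = 0
  · rw [hi', zero_smul, map_zero]
    exact pow_pos (zero_lt_one.trans hx1) _
  · rw [Algebra.smul_def, map_mul, P.valuation_algebraMap hi', one_mul, map_pow]
    apply pow_lt_pow_right₀ hx1
    by_contra! hle
    have : i = g.natDegree := le_antisymm (Nat.lt_succ_iff.1 (Finset.mem_range.1 hi)) hle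
    exact hi' (by rw [this, Polynomial.eraseLead_coeff_natDegree])

theorem valuation_aeval (P : Place F E) {x : E} (hx : x ∉ P.ring) {g : F[X]} (hg : g ≠ 0) :
    P.ring.valuation (Polynomial.aeval x g) = P.ring.valuation x ^ g.natDegree := by
  have h1 : P.ring.valuation (algebraMap F E g.leadingCoeff * x ^ g.natDegree) =
      P.ring.valuation x ^ g.natDegree := by
    rw [map_mul, P.valuation_algebraMap (by simpa using hg), one_mul, map_pow]
  rw [← h1]
  apply Valuation.map_eq_of_sub_lt
  rw [h1]
  exact P.valuation_aeval_sub_lt hx g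

theorem valuation_artinSchreier (P : Place F E) {p : ℕ} (hp : 1 < p) {y : E} (hy : y ∉ P.ring) :
    P.ring.valuation (y ^ p - y) = P.ring.valuation y ^ p := by
  have hy1 := P.one_lt_valuation hy
  rw [← map_pow]
  apply Valuation.map_sub_eq_of_lt_left
  rw [map_pow]
  exact lt_self_pow₀ hy1 hp

/-- A transcendental `x` lies outside the integral closure of `F` in `E`, and an integrally closed
subring is cut out by the valuation rings containing it. -/
theorem exists_notMem {x : E} (hx : Transcendental F x) : ∃ P : Place F E, x ∉ P.ring := by
  have h : x ∉ (integralClosure F E).toSubring := fun h => hx h.isAlgebraic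
  have : IsIntegrallyClosedIn (integralClosure F E).toSubring E :=
    inferInstanceAs (IsIntegrallyClosedIn (integralClosure F E) E)
  obtain ⟨V, hV, hxV⟩ := Subring.exists_le_valuationSubring_of_isIntegrallyClosedIn h
  exact ⟨⟨V, fun a => hV ((integralClosure F E).algebraMap_mem a),
    fun h => hxV (h ▸ ValuationSubring.mem_top x)⟩, hxV⟩

end Place

/-! ### The unique place at infinity -/

section Infinity

variable {F E : Type*} [Field F] [Field E] [Algebra F E] {p : ℕ} {f : F[X]} {x y : E}

/-- Evaluation of bivariate polynomials, the inner variable at `x` and the outer one at `y`. -/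
noncomputable def evalPair (F : Type*) {E : Type*} [Field F] [Field E] [Algebra F E] (x y : E) :
    F[X][X] →+* E :=
  Polynomial.eval₂RingHom (Polynomial.aeval (R := F) x).toRingHom y

/-- The equation `Y ^ p - Y - f(X)` as a polynomial in `Y`. -/
noncomputable def artinSchreierPoly (p : ℕ) {F : Type*} [Field F] (f : F[X]) : F[X][X] :=
  Polynomial.X ^ p - Polynomial.X - Polynomial.C f

theorem evalPair_eq_sum (G : F[X][X]) :
    evalPair F x y G = ∑ j ∈ G.support, Polynomial.aeval x (G.coeff j) * y ^ j := by
  simp [evalPair, Polynomial.eval₂_eq_sum, Polynomial.sum_def]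

@[simp] theorem evalPair_X : evalPair F x y Polynomial.X = y := by simp [evalPair]

@[simp] theorem evalPair_C (g : F[X]) :
    evalPair F x y (Polynomial.C g) = Polynomial.aeval x g := by simp [evalPair]

theorem monic_artinSchreierPoly (hp : 1 < p) (f : F[X]) : (artinSchreierPoly p f).Monic := by
  unfold artinSchreierPoly
  rw [sub_sub]
  apply Polynomial.monic_X_pow_sub
  rw [Polynomial.degree_X_add_C]
  exact_mod_cast hp

theorem natDegree_artinSchreierPoly (hp : 1 < p) (f : F[X]) :
    (artinSchreierPoly p f).natDegree = p := by
  unfold artinSchreierPoly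
  rw [sub_sub, Polynomial.natDegree_sub_eq_left_of_natDegree_lt, Polynomial.natDegree_X_pow]
  rwa [Polynomial.natDegree_X_pow, Polynomial.natDegree_X_add_C]

theorem mem_adjoin_pair_iff {u : E} :
    u ∈ Algebra.adjoin F {x, y} ↔ ∃ G, evalPair F x y G = u := by
  have hx : x ∈ Algebra.adjoin F {x, y} := Algebra.subset_adjoin (by simp)
  have hy : y ∈ Algebra.adjoin F {x, y} := Algebra.subset_adjoin (by simp)
  constructor
  · intro hu
    change u ∈ (evalPair F x y).range
    induction hu using Algebra.adjoin_induction with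
    | mem u hu =>
      rcases hu with rfl | rfl
      · exact ⟨Polynomial.C Polynomial.X, by simp⟩
      · exact ⟨Polynomial.X, by simp⟩
    | algebraMap r => exact ⟨Polynomial.C (Polynomial.C r), by simp⟩
    | add u w _ _ hu hw => exact add_mem hu hw
    | mul u w _ _ hu hw => exact mul_mem hu hw
  · rintro ⟨G, rfl⟩
    rw [evalPair_eq_sum]
    refine sum_mem fun j _ => mul_mem ?_ (pow_mem hy j)
    exact Algebra.adjoin_mono (by simp) (Polynomial.aeval_mem_adjoin_singleton F x)

/-- The weight `p i + 2 j` is the pole order of `x^i y^j`. As `2` is invertible modulo the odd prime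
`p`, it determines `j < p`, and then `i`. -/
theorem exponents_eq_of_weight_eq (hp : p.Prime) (hp2 : p ≠ 2) {i j i' j' : ℕ} (hj : j < p)
    (hj' : j' < p) (h : p * i + 2 * j = p * i' + 2 * j') : i = i' ∧ j = j' := by
  have h1 : 2 * j ≡ 2 * j' [MOD p] := by
    have : (p * i + 2 * j) % p = (p * i' + 2 * j') % p := by rw [h]
    simpa [Nat.ModEq, Nat.mul_add_mod] using this
  have h2 : j = j' := Nat.ModEq.eq_of_lt_of_lt (Nat.ModEq.cancel_left_of_coprime
    ((Nat.coprime_primes hp Nat.prime_two).2 hp2) h1) hj hj'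
  subst h2
  exact ⟨Nat.eq_of_mul_eq_mul_left hp.pos (by omega), rfl⟩

namespace IsArtinSchreierFunctionField

theorem evalPair_artinSchreierPoly (h : IsArtinSchreierFunctionField p f x y) :
    evalPair F x y (artinSchreierPoly p f) = 0 := by
  simp [artinSchreierPoly, h.equation]

theorem notMem_of_notMem (h : IsArtinSchreierFunctionField p f x y) (P : Place F E)
    (hf : f.natDegree = 2) (hx : x ∉ P.ring) :
    y ∉ P.ring := by
  intro hy
  have h1 : y ^ p - y ∈ P.ring := sub_mem (pow_mem hy p) hy
  rw [h.equation, ← P.ring.valuation_le_one_iff,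
    P.valuation_aeval hx (by rintro rfl; simp at hf), hf] at h1
  exact absurd h1 (not_le.2 (one_lt_pow₀ (P.one_lt_valuation hx) two_ne_zero))

theorem valuation_y_pow (h : IsArtinSchreierFunctionField p f x y) (hp : 1 < p) (P : Place F E)
    (hf : f.natDegree = 2) (hx : x ∉ P.ring) :
    P.ring.valuation y ^ p = P.ring.valuation x ^ 2 := by
  rw [← P.valuation_artinSchreier hp (h.notMem_of_notMem P hf hx), h.equation,
    P.valuation_aeval hx (by rintro rfl; simp at hf), hf]

/-- Taking `p`-th powers expresses every value as a power of the value of `x`, so nothing about the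
value group is needed. -/
theorem valuation_monomial_pow (h : IsArtinSchreierFunctionField p f x y) (hp : 1 < p)
    (P : Place F E) (hf : f.natDegree = 2)
    (hx : x ∉ P.ring) (i j : ℕ) :
    P.ring.valuation (x ^ i * y ^ j) ^ p = P.ring.valuation x ^ (p * i + 2 * j) := by
  rw [map_mul, map_pow, map_pow, mul_pow, pow_right_comm _ j p, h.valuation_y_pow hp P hf hx,
    pow_add, pow_mul, pow_mul, pow_right_comm _ i p]

/-- The leading monomial of a polynomial of degree less than `p` in `y` dominates it at every place
where `x` has a pole. -/
theorem exists_leading_monomial (h : IsArtinSchreierFunctionField p f x y) (hp : p.Prime)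
    (hp2 : p ≠ 2) (hf : f.natDegree = 2) {G : F[X][X]}
    (hG : G ≠ 0) (hdeg : G.natDegree < p) :
    ∃ (i j : ℕ) (c : F), c ≠ 0 ∧ j < p ∧ ∀ P : Place F E, x ∉ P.ring →
      P.ring.valuation (evalPair F x y G - algebraMap F E c * (x ^ i * y ^ j)) <
        P.ring.valuation (x ^ i * y ^ j) := by
  obtain ⟨j₀, hj₀, hmax⟩ := Finset.exists_max_image G.support
    (fun j => p * (G.coeff j).natDegree + 2 * j) (Polynomial.support_nonempty.2 hG)
  have hlt (j) (hj : j ∈ G.support) : j < p :=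
    (Polynomial.le_natDegree_of_mem_supp _ hj).trans_lt hdeg
  have hne : G.coeff j₀ ≠ 0 := Polynomial.mem_support_iff.1 hj₀
  refine ⟨(G.coeff j₀).natDegree, j₀, (G.coeff j₀).leadingCoeff, by simpa using hne,
    hlt _ hj₀, fun P hx => ?_⟩
  have hx1 := P.one_lt_valuation hx
  have hx0 : x ≠ 0 := by rintro rfl; exact hx (zero_mem _)
  have hy0 : y ≠ 0 := by rintro rfl; exact h.notMem_of_notMem P hf hx (zero_mem _)
  rw [evalPair_eq_sum, ← Finset.add_sum_erase _ _ hj₀, add_sub_right_comm]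
  refine Valuation.map_add_lt _ ?_ (Valuation.map_sum_lt _ ?_ fun j hj => ?_)
  · rw [← mul_assoc, ← sub_mul, map_mul, map_mul _ (x ^ _), map_pow _ x]
    refine mul_lt_mul_of_pos_right (P.valuation_aeval_sub_lt hx _) ?_
    rw [zero_lt_iff]; simpa using fun h' => absurd h' hy0
  · simp [hx0, hy0]
  · obtain ⟨hjj, hj⟩ := Finset.mem_erase.1 hj
    have hjne : G.coeff j ≠ 0 := Polynomial.mem_support_iff.1 hj
    rw [map_mul, P.valuation_aeval hx hjne, ← map_pow, ← map_mul]
    refine lt_of_pow_lt_pow_left₀ p zero_le ?_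
    rw [h.valuation_monomial_pow hp.one_lt P hf hx, h.valuation_monomial_pow hp.one_lt P hf hx]
    refine pow_lt_pow_right₀ hx1 (lt_of_le_of_ne (hmax j hj) fun heq => hjj ?_)
    exact (exponents_eq_of_weight_eq hp hp2 (hlt _ hj) (hlt _ hj₀) heq).2

theorem exists_reduced (h : IsArtinSchreierFunctionField p f x y) (hp : 1 < p) {u : E}
    (hu : u ∈ Algebra.adjoin F {x, y}) :
    ∃ G : F[X][X], G.natDegree < p ∧ evalPair F x y G = u := by
  obtain ⟨G, rfl⟩ := mem_adjoin_pair_iff.1 hu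
  have hm := monic_artinSchreierPoly hp f
  refine ⟨G %ₘ artinSchreierPoly p f, ?_, ?_⟩
  · have := Polynomial.natDegree_modByMonic_lt G hm (fun h1 => by
      have := natDegree_artinSchreierPoly hp f
      rw [h1, Polynomial.natDegree_one] at this
      omega)
    rwa [natDegree_artinSchreierPoly hp] at this
  · conv_rhs => rw [← Polynomial.modByMonic_add_div G (artinSchreierPoly p f)]
    rw [map_add, map_mul, h.evalPair_artinSchreierPoly, zero_mul, add_zero]

/-- A nonzero remainder modulo the monic equation has a dominating leading monomial at a pole of
`x`, so it cannot evaluate to zero. This determines all relations between `x` and `y`. -/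
theorem artinSchreierPoly_dvd (h : IsArtinSchreierFunctionField p f x y) (hp : p.Prime)
    (hp2 : p ≠ 2) (hf : f.natDegree = 2) {G : F[X][X]} (hG : evalPair F x y G = 0) :
    artinSchreierPoly p f ∣ G := by
  have hm := monic_artinSchreierPoly hp.one_lt f
  rw [← Polynomial.modByMonic_eq_zero_iff_dvd hm]
  by_contra hne
  have hdeg := Polynomial.natDegree_modByMonic_lt G hm (fun h1 => by
    have := natDegree_artinSchreierPoly hp.one_lt f
    rw [h1, Polynomial.natDegree_one] at this
    exact hp.pos.ne this)
  rw [natDegree_artinSchreierPoly hp.one_lt] at hdeg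
  obtain ⟨i, j, c, hc, -, hlt⟩ := h.exists_leading_monomial hp hp2 hf hne hdeg
  obtain ⟨P, hP⟩ := Place.exists_notMem h.transcendental
  have h0 : evalPair F x y (G %ₘ artinSchreierPoly p f) = 0 := by
    have := congrArg (evalPair F x y) (Polynomial.modByMonic_add_div G (artinSchreierPoly p f))
    rwa [map_add, map_mul, h.evalPair_artinSchreierPoly, zero_mul, add_zero, hG] at this
  have := hlt P hP
  rw [h0, zero_sub, Valuation.map_neg, map_mul, P.valuation_algebraMap hc, one_mul] at this
  exact lt_irrefl _ this

theorem exists_div_adjoin (h : IsArtinSchreierFunctionField p f x y) (e : E) :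
    ∃ u ∈ Algebra.adjoin F {x, y}, ∃ w ∈ Algebra.adjoin F {x, y}, e = u / w := by
  have he : e ∈ IntermediateField.adjoin F {x, y} := by rw [h.generates]; trivial
  exact IntermediateField.mem_adjoin_iff_div.1 he

/-- Compare leading monomials of numerator and denominator. The essential point is that `k` and `c`
do not depend on `P`. If `k = 0` the two monomials coincide, and the ratio of their coefficients is
the residue; otherwise `c` carries no information. -/
theorem exists_pole_order (h : IsArtinSchreierFunctionField p f x y) (hp : p.Prime)
    (hp2 : p ≠ 2) (hf : f.natDegree = 2) {e : E} (he : e ≠ 0) :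
    ∃ (k : ℤ) (c : F), ∀ P : Place F E, x ∉ P.ring →
      P.ring.valuation e ^ p = P.ring.valuation x ^ k ∧
        (k = 0 → e - algebraMap F E c ∈ P.ring.nonunits) := by
  obtain ⟨u, hu, w, hw, rfl⟩ := h.exists_div_adjoin e
  obtain ⟨G, hG, rfl⟩ := h.exists_reduced hp.one_lt hu
  obtain ⟨H, hH, rfl⟩ := h.exists_reduced hp.one_lt hw
  have hG0 : G ≠ 0 := by rintro rfl; simp at he
  have hH0 : H ≠ 0 := by rintro rfl; simp at he
  obtain ⟨i, j, c, hc, hj, hlt⟩ := h.exists_leading_monomial hp hp2 hf hG0 hG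
  obtain ⟨i', j', c', hc', hj', hlt'⟩ := h.exists_leading_monomial hp hp2 hf hH0 hH
  refine ⟨((p * i + 2 * j : ℕ) : ℤ) - ((p * i' + 2 * j' : ℕ) : ℤ), c / c', fun P hx => ?_⟩
  have hx0 : x ≠ 0 := by rintro rfl; exact hx (zero_mem _)
  have value {M : F[X][X]} {d : F} (hd : d ≠ 0) {a b : ℕ}
      (hM : P.ring.valuation (evalPair F x y M - algebraMap F E d * (x ^ a * y ^ b)) <
        P.ring.valuation (x ^ a * y ^ b)) :
      P.ring.valuation (evalPair F x y M) = P.ring.valuation (x ^ a * y ^ b) := by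
    have h1 : P.ring.valuation (algebraMap F E d * (x ^ a * y ^ b)) =
        P.ring.valuation (x ^ a * y ^ b) := by
      rw [map_mul, P.valuation_algebraMap hd, one_mul]
    rw [← h1] at hM ⊢
    exact Valuation.map_eq_of_sub_lt _ hM
  have hvG := value hc (hlt P hx)
  have hvH := value hc' (hlt' P hx)
  constructor
  · rw [map_div₀, div_pow, hvG, hvH, h.valuation_monomial_pow hp.one_lt P hf hx,
      h.valuation_monomial_pow hp.one_lt P hf hx, zpow_sub₀ (by simpa using hx0), zpow_natCast,
      zpow_natCast]
  · intro hk
    obtain ⟨rfl, rfl⟩ := exponents_eq_of_weight_eq hp hp2 hj hj'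
      (Nat.cast_injective (sub_eq_zero.1 hk))
    have hw0 : evalPair F x y H ≠ 0 := fun h0 => he (by rw [h0, div_zero])
    have hc'E : algebraMap F E c' ≠ 0 := by simpa using hc'
    have hrw : evalPair F x y G / evalPair F x y H - algebraMap F E (c / c') =
        ((evalPair F x y G - algebraMap F E c * (x ^ i * y ^ j)) - algebraMap F E (c / c') *
          (evalPair F x y H - algebraMap F E c' * (x ^ i * y ^ j))) / evalPair F x y H := by
      rw [map_div₀]
      field_simp
      ring
    rw [ValuationSubring.mem_nonunits_iff, hrw, map_div₀, div_lt_one₀, hvH]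
    · refine Valuation.map_sub_lt _ (hlt P hx) ?_
      rw [map_mul, P.valuation_algebraMap (div_ne_zero hc hc'), one_mul]
      exact hlt' P hx
    · rw [zero_lt_iff]; simpa using hw0

theorem exists_unique_pole (h : IsArtinSchreierFunctionField p f x y) (hp : p.Prime)
    (hp2 : p ≠ 2) (hf : f.natDegree = 2) :
    ∃ P : Place F E, P.degree = 1 ∧ x ∉ P.ring ∧ ∀ Q : Place F E, x ∉ Q.ring → Q = P := by
  obtain ⟨P, hP⟩ := Place.exists_notMem h.transcendental
  -- Membership depends only on the sign of `k`, which is common to all poles of `x`, so their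
  -- valuation rings coincide.
  have mem_iff {e : E} {k : ℤ} {Q : Place F E} (hQ : x ∉ Q.ring)
      (hk : Q.ring.valuation e ^ p = Q.ring.valuation x ^ k) : e ∈ Q.ring ↔ k ≤ 0 := by
    rw [← Q.ring.valuation_le_one_iff, ← pow_le_one_iff_of_nonneg zero_le hp.ne_zero, hk,
      ← zpow_zero (Q.ring.valuation x), zpow_le_zpow_iff_right₀ (Q.one_lt_valuation hQ)]
  refine ⟨P, ?_, hP, fun Q hQ => Place.ext_ring (SetLike.ext fun e => ?_)⟩
  · rw [P.degree_eq_one_iff]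
    intro e heP
    by_cases he : e = 0
    · exact ⟨0, by simp [he]⟩
    obtain ⟨k, c, hkc⟩ := h.exists_pole_order hp hp2 hf he
    obtain ⟨hk, hc⟩ := hkc P hP
    rcases ((mem_iff hP hk).1 heP).lt_or_eq with hk0 | hk0
    · refine ⟨0, ?_⟩
      rw [map_zero, sub_zero, ValuationSubring.mem_nonunits_iff,
        ← pow_lt_one_iff_of_nonneg zero_le hp.ne_zero, hk,
        ← zpow_zero (P.ring.valuation x), zpow_lt_zpow_iff_right₀ (P.one_lt_valuation hP)]
      exact hk0
    · exact ⟨c, hc hk0⟩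
  · by_cases he : e = 0
    · simp [he]
    obtain ⟨k, c, hkc⟩ := h.exists_pole_order hp hp2 hf he
    rw [mem_iff hQ (hkc Q hQ).1, mem_iff hP (hkc P hP).1]

end IsArtinSchreierFunctionField
end Infinity

/-! ### Rational places over affine points -/

section AffinePlaces

variable {F E : Type*} [Field F] [Field E] [Algebra F E] {p : ℕ} {f : F[X]} {x y : E}

/-- Evaluation of a bivariate polynomial at a rational point. -/
noncomputable def evalPoint {F : Type*} [Field F] (a b : F) : F[X][X] →+* F :=
  (Polynomial.evalRingHom a).comp (Polynomial.evalRingHom (Polynomial.C b))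

@[simp] theorem evalPoint_C (a b : F) (g : F[X]) :
    evalPoint a b (Polynomial.C g) = g.eval a := by simp [evalPoint]

@[simp] theorem evalPoint_X (a b : F) : evalPoint a b Polynomial.X = b := by simp [evalPoint]

/-- The ideal of the point is generated by `X - a` and `Y - b`: divide first in the outer variable,
then in the inner one. -/
theorem exists_eq_evalPoint_add (a b : F) (G : F[X][X]) : ∃ (H : F[X][X]) (q : F[X]),
    G = Polynomial.C (Polynomial.C (evalPoint a b G)) +
      (Polynomial.X - Polynomial.C (Polynomial.C b)) * H +
      Polynomial.C ((Polynomial.X - Polynomial.C a) * q) := by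
  obtain ⟨H, hH⟩ := Polynomial.X_sub_C_dvd_sub_C_eval (p := G) (a := Polynomial.C b)
  obtain ⟨q, hq⟩ := Polynomial.X_sub_C_dvd_sub_C_eval (p := G.eval (Polynomial.C b)) (a := a)
  refine ⟨H, q, ?_⟩
  rw [← hH, ← hq, map_sub]
  simp only [evalPoint, RingHom.comp_apply, Polynomial.coe_evalRingHom]
  ring

theorem Place.evalPair_mem (P : Place F E) (hx : x ∈ P.ring) (hy : y ∈ P.ring) (G : F[X][X]) :
    evalPair F x y G ∈ P.ring := by
  rw [evalPair_eq_sum]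
  refine sum_mem fun j _ => mul_mem ?_ (pow_mem hy j)
  rw [Polynomial.aeval_eq_sum_range]
  refine sum_mem fun i _ => ?_
  rw [Algebra.smul_def]
  exact mul_mem (P.algebraMap_mem _) (pow_mem hx i)

theorem Place.mem_of_sub_mem_nonunits (P : Place F E) {z : E} {c : F}
    (h : z - algebraMap F E c ∈ P.ring.nonunits) : z ∈ P.ring := by
  have := add_mem (P.ring.nonunits_subset h) (P.algebraMap_mem c)
  rwa [sub_add_cancel] at this

theorem Place.mul_mem_nonunits (P : Place F E) {z w : E} (hz : z ∈ P.ring.nonunits)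
    (hw : w ∈ P.ring) : z * w ∈ P.ring.nonunits := by
  rw [ValuationSubring.mem_nonunits_iff] at hz ⊢
  rw [map_mul]
  exact mul_lt_one_of_lt_of_le hz ((P.ring.valuation_le_one_iff w).2 hw)

theorem Place.evalPair_sub_mem_nonunits (P : Place F E) {a b : F}
    (hx : x - algebraMap F E a ∈ P.ring.nonunits) (hy : y - algebraMap F E b ∈ P.ring.nonunits)
    (G : F[X][X]) :
    evalPair F x y G - algebraMap F E (evalPoint a b G) ∈ P.ring.nonunits := by
  obtain ⟨H, q, hG⟩ := exists_eq_evalPoint_add a b G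
  have hxP := P.mem_of_sub_mem_nonunits hx
  have hyP := P.mem_of_sub_mem_nonunits hy
  have h1 : evalPair F x y G - algebraMap F E (evalPoint a b G) =
      (y - algebraMap F E b) * evalPair F x y H +
        (x - algebraMap F E a) * evalPair F x y (Polynomial.C q) := by
    conv_lhs => enter [1]; rw [hG]
    simp only [map_add, map_mul, map_sub, evalPair_C, evalPair_X, Polynomial.aeval_C,
      Polynomial.aeval_X]
    ring
  rw [h1]
  exact add_mem (P.mul_mem_nonunits hy (P.evalPair_mem hxP hyP H))
    (P.mul_mem_nonunits hx (P.evalPair_mem hxP hyP _))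

theorem Place.valuation_evalPair_eq_one (P : Place F E) {a b : F}
    (hx : x - algebraMap F E a ∈ P.ring.nonunits) (hy : y - algebraMap F E b ∈ P.ring.nonunits)
    {G : F[X][X]} (hG : evalPoint a b G ≠ 0) : P.ring.valuation (evalPair F x y G) = 1 := by
  have h := P.evalPair_sub_mem_nonunits hx hy G
  rw [ValuationSubring.mem_nonunits_iff] at h
  rw [← P.valuation_algebraMap hG] at h ⊢
  exact Valuation.map_eq_of_sub_lt _ h

namespace IsArtinSchreierFunctionField

theorem ker_evalPair_le (h : IsArtinSchreierFunctionField p f x y) (hp : p.Prime)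
    (hp2 : p ≠ 2) (hf : f.natDegree = 2) {a b : F} (hab : b ^ p - b = f.eval a) :
    RingHom.ker (evalPair F x y) ≤ RingHom.ker (evalPoint a b) := by
  intro G hG
  obtain ⟨H, rfl⟩ := h.artinSchreierPoly_dvd hp hp2 hf hG
  rw [RingHom.mem_ker, map_mul]
  simp [artinSchreierPoly, hab]

/-- The local ring of the curve at a rational affine point is a valuation ring whose maximal ideal
is generated by `x - a`. -/
theorem exists_valuationSubring_at (h : IsArtinSchreierFunctionField p f x y) [CharP F p]
    (hp : p.Prime) (hp2 : p ≠ 2) (hf : f.natDegree = 2) {a b : F}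
    (hab : b ^ p - b = f.eval a) :
    ∃ V : ValuationSubring E,
      (∀ z : E, z ∈ V ↔ ∃ G H : F[X][X], evalPoint a b H ≠ 0 ∧
        z = evalPair F x y G / evalPair F x y H) ∧
      (∀ z ∈ V.nonunits, ∃ w ∈ V, z = (x - algebraMap F E a) * w) ∧
      x - algebraMap F E a ∈ V.nonunits ∧ y - algebraMap F E b ∈ V.nonunits := by
  have : Fact p.Prime := ⟨hp⟩
  have : CharP E p := charP_of_injective_algebraMap' F p
  have hker := h.ker_evalPair_le hp hp2 hf hab
  let S : Subring E := (evalPair F x y).range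
  let π : F[X][X] →+* S := (evalPair F x y).rangeRestrict
  have hπ : Function.Surjective π := (evalPair F x y).rangeRestrict_surjective
  let ε : S →+* F := RingHom.liftOfSurjective π hπ ⟨evalPoint a b, by
    intro G hG
    apply hker
    exact congrArg Subtype.val (RingHom.mem_ker.1 hG)⟩
  have hε (G : F[X][X]) : ε (π G) = evalPoint a b G :=
    RingHom.liftOfRightInverse_comp_apply π _ (Function.rightInverse_surjInv hπ) _ G
  have hπval (G : F[X][X]) : ((π G : S) : E) = evalPair F x y G := rfl
  have : IsNoetherianRing S := isNoetherianRing_of_surjective _ _ π hπ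
  let M : Ideal S := RingHom.ker ε
  have hMprime : M.IsPrime := RingHom.ker_isPrime ε
  let L := LocalSubring.ofPrime S M
  have : IsNoetherianRing L.toSubring :=
    IsLocalization.isNoetherianRing M.primeCompl L.toSubring inferInstance
  let ι : S →+* L.toSubring := algebraMap S L.toSubring
  have hι (s : S) : ((ι s : L.toSubring) : E) = s := rfl
  let t : L.toSubring := ι (π (Polynomial.C (Polynomial.X - Polynomial.C a)))
  have ht : (t : E) = x - algebraMap F E a := by simp [t, hι, hπval]
  let r : L.toSubring := ι (π (Polynomial.X - Polynomial.C (Polynomial.C b)))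
  have hr : (r : E) = y - algebraMap F E b := by simp [r, hι, hπval]
  have hunit (s : S) (hs : ε s ≠ 0) : IsUnit (ι s) :=
    IsLocalization.map_units L.toSubring (⟨s, hs⟩ : M.primeCompl)
  -- Smoothness: subtracting the equation at the point gives `(y - b) * ((y - b) ^ (p - 1) - 1) = (x
  -- - a) * g(x)`, and the second factor on the left takes the value `-1` at the point, so it is a
  -- unit of the local ring.
  have hrt : r ∈ Ideal.span {t} := by
    obtain ⟨g, hg⟩ := Polynomial.X_sub_C_dvd_sub_C_eval (p := f) (a := a)
    let w : F[X][X] := (Polynomial.X - Polynomial.C (Polynomial.C b)) ^ (p - 1) - 1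
    have hw : IsUnit (ι (π w)) := by
      apply hunit
      rw [hε]
      simp [w, zero_pow (Nat.sub_ne_zero_of_lt hp.one_lt)]
    have heq : r * ι (π w) = t * ι (π (Polynomial.C g)) := by
      apply Subtype.ext
      rw [Subring.coe_mul, Subring.coe_mul, hr, ht, hι, hι]
      have h1 : ((π w : S) : E) = (y - algebraMap F E b) ^ (p - 1) - 1 := by simp [hπval, w]
      have h2 : ((π (Polynomial.C g) : S) : E) = Polynomial.aeval x g := by simp [hπval]
      have h3 := congrArg (Polynomial.aeval x) hg
      rw [map_mul, map_sub, map_sub, Polynomial.aeval_C, Polynomial.aeval_C,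
        Polynomial.aeval_X] at h3
      rw [h1, h2, ← h3, mul_sub, mul_one, mul_pow_sub_one hp.ne_zero, sub_pow_char,
        ← h.equation, ← hab, map_sub, map_pow]
      ring
    rw [Ideal.mem_span_singleton]
    exact hw.dvd_mul_right.1 ⟨_, heq⟩
  have hmax : IsLocalRing.maximalIdeal L.toSubring = Ideal.span {t} := by
    rw [← IsLocalization.AtPrime.map_eq_maximalIdeal M L.toSubring]
    apply le_antisymm
    · rw [Ideal.map_le_iff_le_comap]
      intro s hs
      obtain ⟨G, rfl⟩ := hπ s
      obtain ⟨H, q, hG⟩ := exists_eq_evalPoint_add a b G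
      have h0 : evalPoint a b G = 0 := by rw [← hε]; exact hs
      rw [h0, map_zero, map_zero, zero_add, map_mul] at hG
      rw [Ideal.mem_comap, hG, map_add, map_add, map_mul, map_mul, map_mul, map_mul]
      exact add_mem (Ideal.mul_mem_right _ _ hrt)
        (Ideal.mul_mem_right _ _ (Ideal.mem_span_singleton_self t))
    · rw [Ideal.span_singleton_le_iff_mem]
      apply Ideal.mem_map_of_mem
      rw [RingHom.mem_ker, hε]
      simp
  have hprin : (IsLocalRing.maximalIdeal L.toSubring).IsPrincipal := ⟨⟨t, hmax⟩⟩
  -- A Noetherian local domain with principal maximal ideal is a valuation ring.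
  have hval : ValuationRing L.toSubring :=
    ((tfae_of_isNoetherianRing_of_isLocalRing_of_isDomain L.toSubring).out 4 1).1 hprin
  have hLmem (z : E) : z ∈ L.toSubring ↔ ∃ G H : F[X][X], evalPoint a b H ≠ 0 ∧
      z = evalPair F x y G / evalPair F x y H := by
    constructor
    · intro hz
      obtain ⟨u, s, hus⟩ := IsLocalization.exists_mk'_eq M.primeCompl (⟨z, hz⟩ : L.toSubring)
      obtain ⟨G, rfl⟩ := hπ u
      obtain ⟨H, hH⟩ := hπ s
      have hH0 : evalPoint a b H ≠ 0 := by rw [← hε, hH]; exact s.2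
      have h1 := IsLocalization.mk'_spec L.toSubring (π G) s
      rw [hus, ← hH] at h1
      have h2 : z * evalPair F x y H = evalPair F x y G := congrArg Subtype.val h1
      refine ⟨G, H, hH0, ?_⟩
      rw [eq_div_iff, h2]
      intro h0
      exact hH0 (hker h0)
    · rintro ⟨G, H, hH, rfl⟩
      obtain ⟨w, hw⟩ := (hunit (π H) (by rwa [hε])).exists_right_inv
      have hw' : evalPair F x y H * (w : E) = 1 := congrArg Subtype.val hw
      rw [div_eq_mul_inv, ← eq_inv_of_mul_eq_one_right hw']
      exact mul_mem (ι (π G)).2 w.2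
  -- Every element of `E` is a quotient of elements of the coordinate ring, and divisibility in `L`
  -- is total.
  let V : ValuationSubring E := ValuationSubring.ofSubring L.toSubring (by
    intro z
    obtain ⟨u, hu, w, hw, rfl⟩ := h.exists_div_adjoin z
    obtain ⟨G, rfl⟩ := mem_adjoin_pair_iff.1 hu
    obtain ⟨H, rfl⟩ := mem_adjoin_pair_iff.1 hw
    by_cases hG0 : evalPair F x y G = 0
    · left; rw [hG0, zero_div]; exact zero_mem _
    by_cases hH0 : evalPair F x y H = 0
    · left; rw [hH0, div_zero]; exact zero_mem _
    obtain ⟨c, hc | hc⟩ := ValuationRing.cond (ι (π G)) (ι (π H))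
    · right
      have hc' : evalPair F x y G * (c : E) = evalPair F x y H := congrArg Subtype.val hc
      rw [inv_div, ← hc', mul_div_cancel_left₀ _ hG0]
      exact c.2
    · left
      have hc' : evalPair F x y H * (c : E) = evalPair F x y G := congrArg Subtype.val hc
      rw [← hc', mul_div_cancel_left₀ _ hH0]
      exact c.2)
  have hVmem (z : L.toSubring) : (z : E) ∈ V.nonunits ↔ z ∈ IsLocalRing.maximalIdeal L.toSubring :=
    V.coe_mem_nonunits_iff (a := (z : V))
  refine ⟨V, hLmem, fun z hz => ?_, ?_, ?_⟩
  · have hzV : z ∈ L.toSubring := V.nonunits_subset hz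
    have h1 := (hVmem ⟨z, hzV⟩).1 hz
    rw [hmax, Ideal.mem_span_singleton] at h1
    obtain ⟨w, hw⟩ := h1
    refine ⟨w, w.2, ?_⟩
    rw [← ht]
    exact congrArg Subtype.val hw
  · rw [← ht, hVmem, hmax]
    exact Ideal.mem_span_singleton_self t
  · rw [← hr, hVmem, hmax]
    exact hrt

theorem exists_unique_place_at (h : IsArtinSchreierFunctionField p f x y) [CharP F p]
    (hp : p.Prime) (hp2 : p ≠ 2) (hf : f.natDegree = 2) {a b : F}
    (hab : b ^ p - b = f.eval a) :
    ∃ P : Place F E, P.degree = 1 ∧ x - algebraMap F E a ∈ P.ring.nonunits ∧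
      y - algebraMap F E b ∈ P.ring.nonunits ∧
      ∀ Q : Place F E, x - algebraMap F E a ∈ Q.ring.nonunits →
        y - algebraMap F E b ∈ Q.ring.nonunits → Q = P := by
  obtain ⟨V, hmem, hgen, hx, hy⟩ := h.exists_valuationSubring_at hp hp2 hf hab
  have hxa : x - algebraMap F E a ≠ 0 := by
    intro h0
    apply h.transcendental
    rw [sub_eq_zero.1 h0]
    exact isAlgebraic_algebraMap a
  let P : Place F E := ⟨V, fun c => (hmem _).2
    ⟨Polynomial.C (Polynomial.C c), 1, by simp, by simp⟩, by
      rintro rfl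
      rw [ValuationSubring.mem_nonunits_iff_or] at hx
      exact hx.elim hxa fun h' => h' (ValuationSubring.mem_top _)⟩
  have hxP : x - algebraMap F E a ∈ P.ring.nonunits := hx
  have hyP : y - algebraMap F E b ∈ P.ring.nonunits := hy
  refine ⟨P, ?_, hx, hy, fun Q hxQ hyQ => Place.ext_ring (le_antisymm ?_ ?_)⟩
  · rw [P.degree_eq_one_iff]
    intro z hz
    obtain ⟨G, H, hH, rfl⟩ := (hmem z).1 hz
    refine ⟨evalPoint a b G / evalPoint a b H, ?_⟩
    have hH1 := P.valuation_evalPair_eq_one hxP hyP hH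
    have hH0 : evalPair F x y H ≠ 0 := fun h0 => by simp [h0] at hH1
    -- Subtracting the expected residue times the denominator gives a numerator vanishing at the
    -- point.
    have h1 := P.evalPair_sub_mem_nonunits hxP hyP
      (G - Polynomial.C (Polynomial.C (evalPoint a b G / evalPoint a b H)) * H)
    rw [map_sub, map_mul, map_sub, map_mul, evalPair_C, Polynomial.aeval_C, evalPoint_C,
      Polynomial.eval_C, div_mul_cancel₀ _ hH, sub_self, map_zero, sub_zero,
      ValuationSubring.mem_nonunits_iff] at h1
    rw [ValuationSubring.mem_nonunits_iff, div_sub' hH0, map_div₀, hH1, div_one, mul_comm]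
    exact h1
  -- If `z` is not in `V`, then `z⁻¹` is `x - a` times an element of `V`. The latter lies in
  -- `Q.ring`, so `z⁻¹` is a nonunit there, contradicting `z ∈ Q.ring`.
  · intro z hz
    by_contra hzP
    have hz1 : z⁻¹ ∈ V.nonunits := V.inv_mem_nonunits_iff.2 (Or.inr hzP)
    obtain ⟨w, hw, hzw⟩ := hgen _ hz1
    obtain ⟨G, H, hH, rfl⟩ := (hmem w).1 hw
    have hwQ : evalPair F x y G / evalPair F x y H ∈ Q.ring := by
      rw [← Q.ring.valuation_le_one_iff, map_div₀, Q.valuation_evalPair_eq_one hxQ hyQ hH, div_one,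
        Q.ring.valuation_le_one_iff]
      exact Q.evalPair_mem (Q.mem_of_sub_mem_nonunits hxQ) (Q.mem_of_sub_mem_nonunits hyQ) G
    have h2 : z⁻¹ ∈ Q.ring.nonunits := hzw ▸ Q.mul_mem_nonunits hxQ hwQ
    rcases Q.ring.inv_mem_nonunits_iff.1 h2 with h0 | h0
    · exact hzP (h0 ▸ zero_mem _)
    · exact h0 hz
  · intro z hz
    obtain ⟨G, H, hH, rfl⟩ := (hmem z).1 hz
    rw [← Q.ring.valuation_le_one_iff, map_div₀, Q.valuation_evalPair_eq_one hxQ hyQ hH, div_one,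
      Q.ring.valuation_le_one_iff]
    exact Q.evalPair_mem (Q.mem_of_sub_mem_nonunits hxQ) (Q.mem_of_sub_mem_nonunits hyQ) G

/-- A rational place at which `x` is regular lies over a rational point of the affine curve. -/
theorem exists_point_of_mem (h : IsArtinSchreierFunctionField p f x y) (hp : p.Prime)
    {P : Place F E} (hP : P.degree = 1) (hx : x ∈ P.ring) :
    ∃ a b : F, b ^ p - b = f.eval a ∧ x - algebraMap F E a ∈ P.ring.nonunits ∧
      y - algebraMap F E b ∈ P.ring.nonunits := by
  rw [P.degree_eq_one_iff] at hP
  have hfx : Polynomial.aeval x f ∈ P.ring := by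
    rw [← evalPair_C (y := 0)]
    exact P.evalPair_mem hx (zero_mem _) _
  have hy : y ∈ P.ring := by
    by_contra hy
    have h1 := P.valuation_artinSchreier hp.one_lt hy
    rw [h.equation] at h1
    rw [← P.ring.valuation_le_one_iff, h1] at hfx
    exact absurd hfx (not_le.2 (one_lt_pow₀ (P.one_lt_valuation hy) hp.ne_zero))
  obtain ⟨a, ha⟩ := hP x hx
  obtain ⟨b, hb⟩ := hP y hy
  refine ⟨a, b, ?_, ha, hb⟩
  have h1 := P.evalPair_sub_mem_nonunits ha hb (artinSchreierPoly p f)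
  rw [h.evalPair_artinSchreierPoly, zero_sub, ← map_neg, P.algebraMap_mem_nonunits_iff,
    neg_eq_zero] at h1
  simpa [artinSchreierPoly, sub_eq_zero] using h1

/-- The rational places of the function field are the place at infinity and the rational points of
the affine curve. -/
theorem rationalPlaces_finite_and_ncard (h : IsArtinSchreierFunctionField p f x y) [Finite F]
    [CharP F p] (hp : p.Prime) (hp2 : p ≠ 2) (hf : f.natDegree = 2) :
    (rationalPlaces F E).Finite ∧
      (rationalPlaces F E).ncard = 1 + (affinePoints p f).ncard := by
  obtain ⟨P₀, hP₀, hxP₀, huniq⟩ := h.exists_unique_pole hp hp2 hf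
  have hex (c : affinePoints p f) := h.exists_unique_place_at hp hp2 hf c.2
  choose g hg1 hgx hgy hgu using hex
  have hinj : Function.Injective g := by
    intro c d hcd
    have hx1 := hgx c
    have hy1 := hgy c
    rw [hcd] at hx1 hy1
    have hx2 := sub_mem hx1 (hgx d)
    have hy2 := sub_mem hy1 (hgy d)
    rw [sub_sub_sub_cancel_left, ← map_sub, (g d).algebraMap_mem_nonunits_iff, sub_eq_zero]
      at hx2 hy2
    exact Subtype.ext (Prod.ext hx2.symm hy2.symm)
  have heq : rationalPlaces F E = insert P₀ (Set.range g) := by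
    ext P
    constructor
    · intro hP
      by_cases hx : x ∈ P.ring
      · obtain ⟨a, b, hab, ha, hb⟩ := h.exists_point_of_mem hp hP hx
        exact Or.inr ⟨⟨(a, b), hab⟩, (hgu ⟨(a, b), hab⟩ P ha hb).symm⟩
      · exact Or.inl (huniq P hx)
    · rintro (rfl | ⟨c, rfl⟩)
      · exact hP₀
      · exact hg1 c
  have hnot : P₀ ∉ Set.range g := by
    rintro ⟨c, rfl⟩
    exact hxP₀ ((g c).mem_of_sub_mem_nonunits (hgx c))
  have hfin : (Set.range g).Finite := Set.finite_range g
  refine ⟨heq ▸ hfin.insert P₀, ?_⟩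
  rw [heq, Set.ncard_insert_of_notMem hnot hfin, ← Set.image_univ,
    Set.ncard_image_of_injective _ hinj,
    Set.ncard_univ, Nat.card_coe_set_eq, add_comm]

end IsArtinSchreierFunctionField

end AffinePlaces

/-! ### Existence of the function field -/

/-- Any root `y` in an algebraic closure of `F(x)` will do, so irreducibility of the equation is not
needed here. -/
theorem exists_isArtinSchreierFunctionField {F : Type u} [Field F] {p : ℕ} (hp : 1 < p)
    (f : F[X]) : ∃ (E : Type u) (_ : Field E) (_ : Algebra F E) (x y : E),
      IsArtinSchreierFunctionField p f x y := by
  let Ω := AlgebraicClosure (RatFunc F)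
  let x : Ω := algebraMap (RatFunc F) Ω RatFunc.X
  have hx : Transcendental F x :=
    (transcendental_algebraMap_iff (algebraMap (RatFunc F) Ω).injective).2
      RatFunc.transcendental_X
  obtain ⟨y, hy⟩ : ∃ y : Ω, y ^ p - y = Polynomial.aeval x f := by
    have hdeg : (Polynomial.X ^ p - (Polynomial.X + Polynomial.C (Polynomial.aeval x f)) :
        Polynomial Ω).degree ≠ 0 := by
      rw [Polynomial.degree_sub_eq_left_of_degree_lt, Polynomial.degree_X_pow]
      · exact_mod_cast (zero_lt_one.trans hp).ne'
      · rw [Polynomial.degree_X_add_C, Polynomial.degree_X_pow]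
        exact_mod_cast hp
    obtain ⟨y, hy⟩ := IsAlgClosed.exists_root _ hdeg
    refine ⟨y, ?_⟩
    simp only [Polynomial.IsRoot, Polynomial.eval_sub, Polynomial.eval_pow, Polynomial.eval_X,
      Polynomial.eval_add, Polynomial.eval_C] at hy
    linear_combination hy
  let K := IntermediateField.adjoin F {x, y}
  let x' : K := ⟨x, IntermediateField.subset_adjoin F _ (by simp)⟩
  let y' : K := ⟨y, IntermediateField.subset_adjoin F _ (by simp)⟩
  refine ⟨K, inferInstance, inferInstance, x', y', ?_, ?_, ?_⟩
  · exact (transcendental_algebraMap_iff (R := F) (algebraMap K Ω).injective).1 hx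
  · apply Subtype.ext
    have h1 : ((Polynomial.aeval x' f : K) : Ω) = Polynomial.aeval x f :=
      (Polynomial.aeval_algebraMap_apply Ω x' f).symm
    rw [h1, ← hy]
    rfl
  · apply IntermediateField.map_injective K.val
    rw [IntermediateField.adjoin_map, ← AlgHom.fieldRange_eq_map, IntermediateField.fieldRange_val,
      Set.image_pair]
    rfl

/-! ### Counting rational places for quadratic polynomials -/

section Main

variable {p m : ℕ} [Fact p.Prime] {F : Type*} [Field F] [Fintype F] [Algebra (ZMod p) F]

theorem ncard_affinePoints_of_natDegree_two {f : F[X]} (hf : f.natDegree = 2) :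
    (affinePoints p f).ncard = p * traceZeros p (f.coeff 2) (f.coeff 1) (f.coeff 0) := by
  rw [ncard_affinePoints, traceZeros]
  congr 3
  ext a
  rw [Polynomial.eval_eq_sum_range, hf]
  simp only [Finset.sum_range_succ, Finset.sum_range_zero]
  ring_nf

theorem IsArtinSchreierFunctionField.ncard_rationalPlaces (hp : p ≠ 2) {f : F[X]}
    (hf : f.natDegree = 2) {E : Type*} [Field E] [Algebra F E] {x y : E}
    (h : IsArtinSchreierFunctionField p f x y) :
    (rationalPlaces F E).Finite ∧ ((rationalPlaces F E).ncard : ℤ) =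
      1 + p * traceZeros p (f.coeff 2) (f.coeff 1) (f.coeff 0) := by
  have : CharP F p := charP_of_injective_algebraMap' (ZMod p) p
  obtain ⟨h1, h2⟩ := h.rationalPlaces_finite_and_ncard Fact.out hp hf
  refine ⟨h1, ?_⟩
  rw [h2, ncard_affinePoints_of_natDegree_two hf]
  push_cast; rfl

end Main

/-! ### Comparison with the Serre bound -/

theorem le_floor_two_mul_sqrt {N : ℤ} {q : ℕ} (h : N ^ 2 ≤ 4 * q) :
    N ≤ ⌊2 * Real.sqrt q⌋ := by
  rw [Int.le_floor]
  have h1 : (N : ℝ) / 2 ≤ Real.sqrt q := by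
    apply Real.le_sqrt_of_sq_le
    have : (N : ℝ) ^ 2 ≤ 4 * q := by exact_mod_cast h
    linarith
  linarith

theorem pow_lt_mul_floor_sqrt {p k : ℕ} (hp : p.Prime) (hp2 : p ≠ 2) (hq : p ^ (2 * k + 1) ≠ 3) :
    2 * (p : ℤ) ^ (k + 1) < ((p : ℤ) - 1) * ⌊2 * Real.sqrt ((p ^ (2 * k + 1) : ℕ) : ℝ)⌋ := by
  have h2 := hp.two_le
  by_cases hp3 : p = 3
  · subst hp3
    have hk : 1 ≤ k := by
      by_contra! hk
      rw [Nat.lt_one_iff.1 hk] at hq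
      exact hq rfl
    have ht : (3 : ℤ) ≤ 3 ^ k := by
      calc (3 : ℤ) = 3 ^ 1 := by norm_num
        _ ≤ 3 ^ k := pow_le_pow_right₀ (by norm_num) hk
    -- With `t = 3 ^ k ≥ 3` one has `(3 t + 1)² ≤ 12 t²`; the extra `1` yields strictness.
    have h := le_floor_two_mul_sqrt (N := 3 ^ (k + 1) + 1) (q := 3 ^ (2 * k + 1))
      (by
        have h3 : (3 : ℤ) ^ (2 * k + 1) = 3 * (3 ^ k) ^ 2 := by ring
        push_cast
        rw [h3, pow_succ (3 : ℤ) k]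
        nlinarith)
    push_cast at h ⊢
    linarith
  · have h5 : 4 ≤ p := by omega
    have h5' : (4 : ℤ) ≤ p := by exact_mod_cast h5
    have ht : (0 : ℤ) < (p : ℤ) ^ k := by positivity
    -- The crude estimate `4 p^k ≤ 2√q` needs only `p ≥ 4`, and `4 (p - 1) > 2 p`.
    have h := le_floor_two_mul_sqrt (N := 4 * p ^ k) (q := p ^ (2 * k + 1))
      (by
        have h3 : (p : ℤ) ^ (2 * k + 1) = p * (p ^ k) ^ 2 := by ring
        push_cast
        rw [h3]
        nlinarith [mul_le_mul_of_nonneg_left h5' (sq_nonneg ((p : ℤ) ^ k))])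
    have h1 := mul_le_mul_of_nonneg_left h (by linarith : (0 : ℤ) ≤ (p : ℤ) - 1)
    rw [pow_succ]
    nlinarith

theorem floor_two_mul_sqrt_three : ⌊2 * Real.sqrt 3⌋ = 3 := by
  have h := Real.sq_sqrt (by norm_num : (0 : ℝ) ≤ 3)
  have h0 := Real.sqrt_nonneg 3
  rw [Int.floor_eq_iff]
  constructor <;> push_cast <;> nlinarith

theorem serre_comparison {p m : ℕ} (hp : p.Prime) (hp2 : p ≠ 2) (hm : Odd m) :
    ((((p : ℤ) ^ m + 1 + (p : ℤ) ^ ((m + 1) / 2) : ℤ) : ℝ) ≤ serreBound p (p ^ m) 2) ∧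
      ((((p : ℤ) ^ m + 1 + (p : ℤ) ^ ((m + 1) / 2) : ℤ) : ℝ) < serreBound p (p ^ m) 2 ↔
        p ^ m ≠ 3) := by
  obtain ⟨k, rfl⟩ := hm
  have hk : (2 * k + 1 + 1) / 2 = k + 1 := by omega
  rw [hk]
  by_cases hq : p ^ (2 * k + 1) = 3
  · have hp3 : p = 3 := by
      have h1 : p ∣ 3 := hq ▸ dvd_pow_self p (by omega)
      exact (Nat.prime_dvd_prime_iff_eq hp Nat.prime_three).1 h1
    subst hp3
    have hk0 : k = 0 := by
      have := Nat.pow_right_injective (le_refl 2 |>.trans (by norm_num : 2 ≤ 3))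
        (hq.trans (pow_one 3).symm)
      omega
    subst hk0
    -- For `q = 3` both bounds equal `3 + 1 + 3`, the only case of equality.
    have he : serreBound 3 (3 ^ (2 * 0 + 1)) 2 = 7 := by
      simp [serreBound, floor_two_mul_sqrt_three]; norm_num
    rw [he]
    norm_num
  · have h := pow_lt_mul_floor_sqrt hp hp2 hq
    have h' : 2 * (p : ℝ) ^ (k + 1) <
        ((p : ℝ) - 1) * (⌊2 * Real.sqrt ((p ^ (2 * k + 1) : ℕ) : ℝ)⌋ : ℝ) := by exact_mod_cast h
    have hlt : (((p : ℤ) ^ (2 * k + 1) + 1 + (p : ℤ) ^ (k + 1) : ℤ) : ℝ) <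
        serreBound p (p ^ (2 * k + 1)) 2 := by
      unfold serreBound
      rw [Int.cast_add, Int.cast_add, Int.cast_pow, Int.cast_pow, Int.cast_natCast, Int.cast_one,
        Nat.cast_pow p (2 * k + 1)]
      rw [Nat.cast_pow p (2 * k + 1)] at h'
      push_cast
      linarith
    exact ⟨hlt.le, fun _ => hq, fun _ => hlt⟩

/-! ### The main theorem -/

theorem theorem5p5 {p m : ℕ} [Fact p.Prime] (hp : p ≠ 2)
    {F : Type u} [Field F] [Fintype F] [DecidableEq F] [Algebra (ZMod p) F]
    (hq : Fintype.card F = p ^ m) (φ : F ≃ₗ[ZMod p] (Fin m → ZMod p)) :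
    (∀ f : F[X], f.natDegree = 2 →
      ∀ (E : Type v) [Field E] [Algebra F E] (x y : E), IsArtinSchreierFunctionField p f x y →
        (rationalPlaces F E).Finite ∧ ((rationalPlaces F E).ncard : ℤ) ≤ codeBound φ 2) ∧
    (Odd m → codeBound φ 2 = (p : ℤ) ^ m + 1 + (p : ℤ) ^ ((m + 1) / 2)) ∧
    (Even m → codeBound φ 2 = (p : ℤ) ^ m + 1 + ((p : ℤ) - 1) * (p : ℤ) ^ (m / 2)) ∧
    (∃ f : F[X], f.natDegree = 2 ∧
      ∃ (E : Type u) (_ : Field E) (_ : Algebra F E) (x y : E),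
        IsArtinSchreierFunctionField p f x y ∧
        (rationalPlaces F E).Finite ∧ ((rationalPlaces F E).ncard : ℤ) = codeBound φ 2) ∧
    (Odd m → (codeBound φ 2 : ℝ) ≤ serreBound p (p ^ m) 2 ∧
      ((codeBound φ 2 : ℝ) < serreBound p (p ^ m) 2 ↔ p ^ m ≠ 3)) := by
  have hbound := codeBound_two_eq hp hq φ
  have hodd (hm : Odd m) : codeBound φ 2 = (p : ℤ) ^ m + 1 + (p : ℤ) ^ ((m + 1) / 2) := by
    rw [hbound, quadraticExcess, if_neg (Nat.not_even_iff_odd.2 hm)]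
  refine ⟨fun f hf E _ _ x y h => ?_, hodd, fun hm => ?_, ?_, fun hm => ?_⟩
  · obtain ⟨hfin, hcard⟩ := h.ncard_rationalPlaces hp hf
    have hlead : f.coeff 2 ≠ 0 := by
      rw [← hf]
      exact Polynomial.leadingCoeff_ne_zero.2 (by rintro rfl; simp at hf)
    refine ⟨hfin, ?_⟩
    rw [hcard, hbound]
    linarith [mul_traceZeros_le hp hq hlead (f.coeff 1) (f.coeff 0)]
  · rw [hbound, quadraticExcess, if_pos hm]
  · obtain ⟨b, a, hb, hba⟩ := exists_traceZeros_eq (F := F) hp hq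
    let f : F[X] := Polynomial.C b * Polynomial.X ^ 2 + Polynomial.C a * Polynomial.X +
      Polynomial.C 0
    have hf : f.natDegree = 2 := Polynomial.natDegree_quadratic hb
    obtain ⟨E, hE, hA, x, y, h⟩ :=
      exists_isArtinSchreierFunctionField (Fact.out : p.Prime).one_lt f
    obtain ⟨hfin, hcard⟩ := h.ncard_rationalPlaces hp hf
    refine ⟨f, hf, E, hE, hA, x, y, h, hfin, ?_⟩
    have h2 : f.coeff 2 = b := by simp [f]
    have h1 : f.coeff 1 = a := by simp [f, Polynomial.coeff_X_pow]
    have h0 : f.coeff 0 = 0 := by simp [f]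
    rw [hcard, h2, h1, h0, hba, hbound]
    ring
  · rw [hodd hm]
    exact serre_comparison Fact.out hp hm
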